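/- **Theorem (1st virial theorem).** Let $\mathcal H$ be a complex Hilbert space, $\Lambda\ge 1$ a selfadjoint operator on $\mathcal H$, and $\mathcal D\subset\mathcal H$ a core for $\Lambda$. For a symmetric operator $X$ on $\mathcal D$, the triple $(X,\Lambda,\mathcal D)$ is called a *GJN triple* if there is a constant $k<\infty$ such that, for all $\psi\in\mathcal D$, $$\|X\psi\|\le k\|\Lambda\psi\|,\qquad \pm i\{\langle X\psi,\Lambda\psi\rangle-\langle \Lambda\psi,X\psi\rangle\}\le k\langle\psi,\Lambda\psi\rangle .$$ For operators $S,T$ and a constant $k$, "$S\le kT$ in the sense of Kato on $\mathcal D$" means that $\mathcal D\subset D(S)\cap D(T)$ and $\|S\psi\|\le k(\|T\psi\|+\|\psi\|)$ for all $\psi\in\mathcal D$. Let $L,N,D,C_0,C_1,C_2,C_3$ be symmetric operators on $\mathcal D$, each forming a GJN triple with $\Lambda$; their closures (which are selfadjoint) are denoted by the same letters. Suppose that $N\ge 0$. Let $A$ be a selfadjoint operator such that $\mathcal D\subset D(A)$, such that $e^{itA}D(\Lambda)\subset D(\Lambda)$ for all $t\in\mathbb R$, and such that $\mathcal D$ is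 a joint core for $\Lambda$ and $A$, i.e. $\mathcal D$ is dense in $D(\Lambda)\cap D(A)$ with respect to the norm $\|\psi\|+\|\Lambda\psi\|+\|A\psi\|$. Suppose that $C_0=L$ and that, for all $\varphi,\psi\in\mathcal D$, $$\langle\varphi,D\psi\rangle=i\{\langle L\varphi,N\psi\rangle-\langle N\varphi,L\psi\rangle\},$$ $$\langle\varphi,C_n\psi\rangle=i\{\langle C_{n-1}\varphi,A\psi\rangle-\langle A\varphi,C_{n-1}\psi\rangle\},\qquad n=1,2,3 .$$ Suppose finally that for some $0\le k,k',p<\infty$ and all $t\in\mathbb R$, in the sense of Kato on $\mathcal D$, $$D\le kN^{1/2},\qquad e^{itA}C_1e^{-itA}\le ke^{k'|t|}N^p,\qquad e^{itA}C_3e^{-itA}\le ke^{k'|t|}N^{1/2}.$$ Let $\psi$ be an eigenvector of $L$. Then there is a family $(\psi_\alpha)_{\alpha>0}\subset D(L)\cap D(C_1)$ such that, as $\alpha\to0$, $\psi_\alpha\to\psi$ and $$\langle\psi_\alpha,C_1\psi_\alpha\rangle\to 0 .$$ -/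

import Mathlib

open Filter Topology

noncomputable section

namespace Virial

variable {H : Type*} [NormedAddCommGroup H] [InnerProductSpace ℂ H] [CompleteSpace H]

/-! ### Operators given on a domain, and the GJN condition -/

/-- The closed operator determined by an operator `X` that is given on the domain `𝒟`: the closure
of `X`. When `X` is essentially self-adjoint on `𝒟`, this is the self-adjoint operator that
`X` determines. -/
def closedOp {𝒟 : Submodule ℂ H} (X : 𝒟 →ₗ[ℂ] H) : H →ₗ.[ℂ] H :=
  (LinearPMap.mk 𝒟 X).closure

/-- `X` is a symmetric operator on `𝒟`. -/
def IsSymmetricOn {𝒟 : Submodule ℂ H} (X : 𝒟 →ₗ[ℂ] H) : Prop :=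
  ∀ φ ψ : 𝒟, inner ℂ (X φ) (ψ : H) = inner ℂ (φ : H) (X ψ)

/-- `Y` is a self-adjoint operator with `Y ≥ 1`, and `𝒟` is a core for `Y`. -/
structure IsReference (Y : H →ₗ.[ℂ] H) (𝒟 : Submodule ℂ H) : Prop where
  selfAdjoint : IsSelfAdjoint Y
  one_le : ∀ ψ : Y.domain, ‖(ψ : H)‖ ^ 2 ≤ (inner ℂ (ψ : H) (Y ψ)).re
  core : Y.HasCore 𝒟

/-- `(X, Y, 𝒟)` is a GJN (Glimm-Jaffe-Nelson) triple: `𝒟` is a core for the self-adjoint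
operator `Y ≥ 1`, `X` is symmetric on `𝒟`, and there is a finite constant `k` such that
`‖X ψ‖ ≤ k ‖Y ψ‖` and `± i (⟪X ψ, Y ψ⟫ - ⟪Y ψ, X ψ⟫) ≤ k ⟪ψ, Y ψ⟫` for all `ψ ∈ 𝒟`.
(The numbers compared in the last inequality are real.) -/
def IsGJNTriple {𝒟 : Submodule ℂ H} (X : 𝒟 →ₗ[ℂ] H) (Y : H →ₗ.[ℂ] H) : Prop :=
  IsReference Y 𝒟 ∧ IsSymmetricOn X ∧
    ∃ k : ℝ, ∀ (ψ : 𝒟) (hψ : (ψ : H) ∈ Y.domain),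
      ‖X ψ‖ ≤ k * ‖Y ⟨ψ, hψ⟩‖ ∧
      (Complex.I * (inner ℂ (X ψ) (Y ⟨ψ, hψ⟩) - inner ℂ (Y ⟨ψ, hψ⟩) (X ψ))).re ≤
        k * (inner ℂ (ψ : H) (Y ⟨ψ, hψ⟩)).re ∧
      -(Complex.I * (inner ℂ (X ψ) (Y ⟨ψ, hψ⟩) - inner ℂ (Y ⟨ψ, hψ⟩) (X ψ))).re ≤
        k * (inner ℂ (ψ : H) (Y ⟨ψ, hψ⟩)).re

/-! ### The unitary group of a self-adjoint operator -/

/-- `U` is a strongly continuous one-parameter group of isometries (hence of unitaries) whose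
generator is `i A`: a vector `ψ` is in the domain of `A` if and only if `t ↦ U t ψ` is
differentiable at `0`, and then the derivative is `i A ψ`. -/
structure IsUnitaryGroupOf (A : H →ₗ.[ℂ] H) (U : ℝ → H →L[ℂ] H) : Prop where
  map_zero : U 0 = 1
  map_add : ∀ s t, U (s + t) = U s * U t
  norm_map : ∀ t ψ, ‖U t ψ‖ = ‖ψ‖
  continuous : ∀ ψ, Continuous fun t => U t ψ
  generator : ∀ ψ η, HasDerivAt (fun t => U t ψ) η 0 ↔
    ∃ h : ψ ∈ A.domain, η = Complex.I • A ⟨ψ, h⟩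

open Classical in
/-- `unitaryGroup A t` is `e^{itA}`: the unique strongly continuous unitary group generated by the
self-adjoint operator `A`. The value when there is no such group (so `A` is not
self-adjoint) is irrelevant. -/
def unitaryGroup (A : H →ₗ.[ℂ] H) : ℝ → H →L[ℂ] H :=
  if h : ∃ U : ℝ → H →L[ℂ] H, IsUnitaryGroupOf A U then h.choose else fun _ => 1

/-- The operator `e^{itA} T e^{-itA}` on its natural domain
`{ψ | e^{-itA} ψ ∈ D(T)}`. -/
def conjBy (A : H →ₗ.[ℂ] H) (t : ℝ) (T : H →ₗ.[ℂ] H) : H →ₗ.[ℂ] H where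
  domain := T.domain.comap (unitaryGroup A (-t)).toLinearMap
  toFun := (unitaryGroup A t).toLinearMap ∘ₗ T.toFun ∘ₗ
    ((unitaryGroup A (-t)).toLinearMap.restrict
      (p := T.domain.comap (unitaryGroup A (-t)).toLinearMap) (q := T.domain) fun _ h => h)

/-! ### Real powers of a nonnegative self-adjoint operator -/

/-- The bounded operator `R` is a two-sided inverse of `1 + T : D(T) → H`. -/
def IsOneAddInverse (T : H →ₗ.[ℂ] H) (R : H →L[ℂ] H) : Prop :=
  (∀ φ : H, ∃ h : R φ ∈ T.domain, R φ + T ⟨R φ, h⟩ = φ) ∧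
    ∀ ψ : T.domain, R ((ψ : H) + T ψ) = ψ

open Classical in
/-- `(1 + T)⁻¹` for a nonnegative self-adjoint operator `T`. The value when `1 + T` has no bounded
inverse is irrelevant. -/
def oneAddInv (T : H →ₗ.[ℂ] H) : H →L[ℂ] H :=
  if h : ∃ R : H →L[ℂ] H, IsOneAddInverse T R then h.choose else 0

/-- The power `T ^ p` (`0 ≤ p < ∞`) of a nonnegative self-adjoint operator `T`, with its natural
domain. With `R = (1 + T)⁻¹`, so that `0 ≤ R ≤ 1`, `R` is injective and `T R = 1 - R`, it
is the operator `(R ^ p)⁻¹ (1 - R) ^ p`. That is, `T ^ p ψ = η` if and only if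
`R ^ p η = (1 - R) ^ p ψ`; in a spectral representation of `T` as multiplication by `x ≥ 0`
this says `(1 + x)⁻ᵖ η = (x / (1 + x)) ^ p ψ`, or `η = x ^ p ψ`. -/
def rpow (T : H →ₗ.[ℂ] H) (p : ℝ) : H →ₗ.[ℂ] H :=
  (LinearMap.ker
    ((cfc (fun r : ℝ => r ^ p) (oneAddInv T)).toLinearMap ∘ₗ LinearMap.snd ℂ H H -
      (cfc (fun r : ℝ => (1 - r) ^ p) (oneAddInv T)).toLinearMap ∘ₗ
        LinearMap.fst ℂ H H)).toLinearPMap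

/-! ### Relative bounds and joint cores -/

/-- `S ≤ k T` in the sense of Kato on `𝒟`: both operators are defined on `𝒟`, and
`‖S ψ‖ ≤ k (‖T ψ‖ + ‖ψ‖)` for all `ψ ∈ 𝒟`. -/
def KatoBoundOn (𝒟 : Submodule ℂ H) (S T : H →ₗ.[ℂ] H) (k : ℝ) : Prop :=
  ∃ (hS : 𝒟 ≤ S.domain) (hT : 𝒟 ≤ T.domain), ∀ ψ : 𝒟,
    ‖S ⟨ψ, hS ψ.2⟩‖ ≤ k * (‖T ⟨ψ, hT ψ.2⟩‖ + ‖(ψ : H)‖)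

/-- `𝒟 ⊆ D(S) ∩ D(T)` is a joint core for `S` and `T`: it is dense in `D(S) ∩ D(T)` with respect to
the norm `‖ψ‖ + ‖S ψ‖ + ‖T ψ‖`. -/
def IsJointCore (𝒟 : Submodule ℂ H) (S T : H →ₗ.[ℂ] H) : Prop :=
  ∃ (hS : 𝒟 ≤ S.domain) (hT : 𝒟 ≤ T.domain),
    ∀ (ψ : H) (h₁ : ψ ∈ S.domain) (h₂ : ψ ∈ T.domain) (ε : ℝ), 0 < ε → ∃ φ : 𝒟,
      ‖(φ : H) - ψ‖ + ‖S ⟨φ, hS φ.2⟩ - S ⟨ψ, h₁⟩‖ + ‖T ⟨φ, hT φ.2⟩ - T ⟨ψ, h₂⟩‖ < ε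

end Virial

end

set_option linter.unusedSectionVars false

noncomputable section

namespace Virial

variable {H : Type*} [NormedAddCommGroup H] [InnerProductSpace ℂ H] [CompleteSpace H]

/-! ### Resolvents -/

/-! Formally `C₁ = i[L, A]`, so its expectation vanishes in an eigenvector of `L`. The difficulty is
that `ψ` need lie neither in `D(A)` nor in `D(C₁)`. The proof first smooths `ψ` with respect to `N`,
then averages over `U t = e^{itA}`.

Everything is expressed through `G = Λ⁻¹`. The GJN bounds make `Z = X G` bounded and turn the
commutator with `Λ` into `|Im ⟪h, Z h⟫| ≤ k ⟪G h, h⟫` (`IsGJNTriple.exists_relativization`).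
Smoothing applies `(ε Λ + 1 + i ν N)⁻¹` to a vector of `𝒟` that is close to `ψ` in the graph norm of
`L`. Pairing the equation with its solution `b` bounds `ν ⟪b, N b⟫`. Commuting `L - e` through the
equation produces `ν D b`, of size `√ν` because `D ≤ k N^{1/2}`, and `ε [Λ, L]`, controlled by the
energy `ε ⟪b, Λ b⟫`, which vanishes with `ε`. Thus `‖(L - e) b‖ = O(√ν)` and `⟪b, N b⟫ ≤ O(1/ν)`
(`exists_approximate_eigenvectors`).

Next average `U t b` over `m + 1` equidistant `t` in `[-α/2, α/2]`. The form of `C₁` becomes a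
double mean of entries `⟪U s b, C₁ U t b⟫`. The function `f x = ⟪U (x - a) b, L U (x + a) b⟫` has
`C₁, C₂, C₃` as successive derivatives (`IsTransported.hasDerivAt_inner`). Symmetrizing under
reflection of the nodes cancels the `C₂` contribution, and `norm_symm_add_sub_le` replaces each
off-diagonal entry by a difference quotient of `f`, with an error of order `α²` times a bound on
`C₃`. That quotient is a commutator of `L` with `U ((k - j) τ)`, divided by `(k - j) τ`. The crucial
point is that `∑ U ((k - j) τ) / (k - j)` has norm at most `M π`, for `M = m + 1`, without a
logarithm (`norm_sum_star_pow_mul_pow_le_of_mem_unitary`), so the main term is `O(‖(L - e) b‖ / α)`,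
uniformly in `m`.

With `ν = α³` the main term and the `C₃` error are both `O(√α)`. The diagonal entries are `O(1/m)`
for fixed `b` and disappear for large `m`; the bound on `C₁` serves only to make their constant
finite (`norm_inner_average_le`, `exists_near_inner_small`). -/

/-- `R` is a bounded two-sided inverse of `T - z`. -/
structure IsResolvent (T : H →ₗ.[ℂ] H) (z : ℂ) (R : H →L[ℂ] H) : Prop where
  mem_graph : ∀ h, (R h, h + z • R h) ∈ T.graph
  apply_sub : ∀ x y, (x, y) ∈ T.graph → R (y - z • x) = x

/-- A closed operator that is bounded below and has dense range is boundedly invertible. -/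
theorem exists_isResolvent_of_isClosed {T : H →ₗ.[ℂ] H} (hT : T.IsClosed) {z : ℂ} {c : ℝ}
    (hc : 0 < c) (hb : ∀ x y, (x, y) ∈ T.graph → c * ‖x‖ ≤ ‖y - z • x‖)
    (hd : ∀ w : H, (∀ x y, (x, y) ∈ T.graph → inner ℂ (y - z • x) w = 0) → w = 0) :
    ∃ R : H →L[ℂ] H, IsResolvent T z R ∧ ∀ h, c * ‖R h‖ ≤ ‖h‖ := by
  have : CompleteSpace T.graph := (show IsClosed (T.graph : Set (H × H)) from hT).completeSpace_coe
  -- On the graph, a Banach space because `T` is closed, `T - z` is a bounded map; a lower bound and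
  -- dense range make it bijective.
  let F : T.graph →L[ℂ] H :=
    (ContinuousLinearMap.snd ℂ H H - z • ContinuousLinearMap.fst ℂ H H) ∘L T.graph.subtypeL
  have hF : ∀ p : T.graph, F p = p.1.2 - z • p.1.1 := fun p => rfl
  have hbd : ∀ p : T.graph, ‖p‖ ≤ (1 + (1 + ‖z‖) / c) * ‖F p‖ := by
    rintro ⟨⟨x, y⟩, hp⟩
    have h1 := hb x y hp
    rw [hF]
    have hx : ‖x‖ ≤ ‖y - z • x‖ / c := by rw [le_div_iff₀ hc]; linarith
    have hy : ‖y‖ ≤ ‖y - z • x‖ + ‖z‖ * ‖x‖ := by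
      have := norm_add_le (y - z • x) (z • x)
      rwa [sub_add_cancel, norm_smul] at this
    have hpos : 0 ≤ ‖y - z • x‖ / c := by positivity
    have h2 : ‖z‖ * ‖x‖ ≤ ‖z‖ * (‖y - z • x‖ / c) := by gcongr
    have h3 : (1 + (1 + ‖z‖) / c) * ‖y - z • x‖ =
      ‖y - z • x‖ + ‖y - z • x‖ / c + ‖z‖ * (‖y - z • x‖ / c) := by field_simp; ring
    have h4 : 0 ≤ ‖z‖ * (‖y - z • x‖ / c) := by positivity
    change max ‖x‖ ‖y‖ ≤ (1 + (1 + ‖z‖) / c) * ‖y - z • x‖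
    rw [h3]
    apply max_le <;> linarith [norm_nonneg (y - z • x)]
  have hanti : AntilipschitzWith (Real.toNNReal (1 + (1 + ‖z‖) / c)) F := by
    apply ContinuousLinearMap.antilipschitz_of_bound
    intro p
    rw [Real.coe_toNNReal _ (by positivity)]
    exact hbd p
  have hdense : (LinearMap.range F.toLinearMap).topologicalClosure = ⊤ := by
    rw [Submodule.topologicalClosure_eq_top_iff, Submodule.eq_bot_iff]
    intro w hw
    refine hd w fun x y hxy => ?_
    exact (Submodule.mem_orthogonal _ w).1 hw _ ⟨⟨(x, y), hxy⟩, rfl⟩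
  have hbij : Function.Bijective F :=
    (ContinuousLinearMap.bijective_iff_dense_range_and_antilipschitz F).2 ⟨hdense, _, hanti⟩
  let e := ContinuousLinearEquiv.ofBijective F (LinearMap.ker_eq_bot.2 hbij.1)
    (LinearMap.range_eq_top.2 hbij.2)
  have he : ∀ p, e p = F p := fun p => rfl
  let R : H →L[ℂ] H := ContinuousLinearMap.fst ℂ H H ∘L T.graph.subtypeL ∘L e.symm
  have hR : ∀ h, R h = (e.symm h).1.1 := fun h => rfl
  have hy : ∀ h, (e.symm h).1.2 = h + z • R h := by
    intro h
    have : F (e.symm h) = h := by rw [← he, e.apply_symm_apply]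
    rw [hF, sub_eq_iff_eq_add] at this
    rw [this, hR]
  have hmem : ∀ h, (R h, h + z • R h) ∈ T.graph := by
    intro h
    rw [← hy, hR]
    exact (e.symm h).2
  refine ⟨R, ⟨hmem, fun x y hxy => ?_⟩, fun h => ?_⟩
  · have : e.symm (y - z • x) = ⟨(x, y), hxy⟩ := by
      rw [ContinuousLinearEquiv.symm_apply_eq, he, hF]
    rw [hR, this]
  · have := hb _ _ (hmem h)
    rwa [add_sub_cancel_right] at this

theorem inner_graph_of_isSelfAdjoint {A : H →ₗ.[ℂ] H} (hA : IsSelfAdjoint A) {x y u v : H}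
    (hx : (x, y) ∈ A.graph) (hu : (u, v) ∈ A.graph) : inner ℂ y u = inner ℂ x v := by
  rw [LinearPMap.mem_graph_iff] at hx hu
  obtain ⟨a, rfl, rfl⟩ := hx
  obtain ⟨b, rfl, rfl⟩ := hu
  have h := LinearPMap.adjoint_isFormalAdjoint hA.dense_domain
  rw [LinearPMap.isSelfAdjoint_def.1 hA] at h
  exact h a b

theorem mem_graph_of_isSelfAdjoint {A : H →ₗ.[ℂ] H} (hA : IsSelfAdjoint A) {u v : H}
    (h : ∀ x y, (x, y) ∈ A.graph → inner ℂ v x = inner ℂ u y) : (u, v) ∈ A.graph := by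
  have h' : ∀ x : A.domain, inner ℂ v (x : H) = inner ℂ u (A x) := fun x => h _ _ (A.mem_graph x)
  have hm : u ∈ (A.adjoint).domain := LinearPMap.mem_adjoint_domain_of_exists u ⟨v, h'⟩
  have he := LinearPMap.adjoint_apply_eq hA.dense_domain ⟨u, hm⟩ h'
  have hg : (u, v) ∈ (A.adjoint).graph := he ▸ (A.adjoint).mem_graph ⟨u, hm⟩
  rwa [LinearPMap.isSelfAdjoint_def.1 hA] at hg

/-- A self-adjoint operator `T` has a resolvent at `z` if `T - z` and `T - conj z` are bounded
below. -/
theorem exists_isResolvent_of_isSelfAdjoint {T : H →ₗ.[ℂ] H} (hT : IsSelfAdjoint T) {z : ℂ} {c : ℝ}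
    (hc : 0 < c) (hb : ∀ x y, (x, y) ∈ T.graph → c * ‖x‖ ≤ ‖y - z • x‖)
    (hb' : ∀ x y, (x, y) ∈ T.graph → c * ‖x‖ ≤ ‖y - (starRingEnd ℂ z) • x‖) :
    ∃ R : H →L[ℂ] H, IsResolvent T z R ∧ ∀ h, c * ‖R h‖ ≤ ‖h‖ := by
  refine exists_isResolvent_of_isClosed hT.isClosed hc hb fun w hw => ?_
  -- A vector orthogonal to the range of `T - z` satisfies `T w = conj z • w`, which the second
  -- lower bound excludes.
  have hm : (w, (starRingEnd ℂ z) • w) ∈ T.graph := by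
    refine mem_graph_of_isSelfAdjoint hT fun x y hxy => ?_
    have := hw x y hxy
    rw [inner_sub_left, inner_smul_left, sub_eq_zero] at this
    rw [inner_smul_left, Complex.conj_conj, ← inner_conj_symm w y, this, map_mul,
      Complex.conj_conj, inner_conj_symm]
  have := hb' _ _ hm
  rw [sub_self, norm_zero] at this
  have h0 : ‖w‖ ≤ 0 := by nlinarith [norm_nonneg w]
  exact norm_le_zero_iff.1 h0

/-- The resolvent identity `R - S = (z - w) R S` also holds with the roles exchanged; compare the
two. -/
theorem IsResolvent.comm {T : H →ₗ.[ℂ] H} {z w : ℂ} {R S : H →L[ℂ] H} (hR : IsResolvent T z R)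
    (hS : IsResolvent T w S) : R * S = S * R := by
  have key : ∀ {z w : ℂ} {R S : H →L[ℂ] H}, IsResolvent T z R → IsResolvent T w S →
      ∀ h, R h - S h = (z - w) • R (S h) := by
    intro z w R S hR hS h
    have h1 := hR.apply_sub _ _ (hS.mem_graph h)
    have h2 : h + w • S h - z • S h = h - (z - w) • S h := by rw [sub_smul]; abel
    rw [h2, map_sub, map_smul, sub_eq_iff_eq_add] at h1
    rw [h1, add_sub_cancel_left]
  by_cases hzw : z = w
  · subst hzw
    have : ∀ h, R h = S h := fun h => by
      have := key hR hS h
      rwa [sub_self, zero_smul, sub_eq_zero] at this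
    have : R = S := ContinuousLinearMap.ext this
    rw [this]
  · ext h
    have h1 := key hR hS h
    have h2 := key hS hR h
    have h3 : (z - w) • R (S h) = (z - w) • S (R h) := by
      rw [← h1, ← neg_sub (S h), h2, ← neg_smul, neg_sub]
    exact smul_right_injective H (sub_ne_zero.2 hzw) h3

/-- Since `⟪x, A x⟫` is real, the imaginary part of `⟪x, (A - i s) x⟫` is `-s ‖x‖²`, which bounds `A
- i s` below by `|s|` for both signs of `s`. -/
theorem exists_isResolvent_I_mul {A : H →ₗ.[ℂ] H} (hA : IsSelfAdjoint A) {t : ℝ} (ht : t ≠ 0) :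
    ∃ R : H →L[ℂ] H, IsResolvent A (t * Complex.I) R ∧ ∀ h, |t| * ‖R h‖ ≤ ‖h‖ := by
  have key : ∀ s : ℝ, ∀ x y, (x, y) ∈ A.graph → |s| * ‖x‖ ≤ ‖y - (s * Complex.I) • x‖ := by
    intro s x y hxy
    have hreal : (inner ℂ x y).im = 0 := by
      have h := inner_graph_of_isSelfAdjoint hA hxy hxy
      rw [← Complex.conj_eq_iff_im, inner_conj_symm, h]
    have h1 : (inner ℂ x (y - (s * Complex.I) • x)).im = -(s * ‖x‖ ^ 2) := by
      rw [inner_sub_right, inner_smul_right, inner_self_eq_norm_sq_to_K]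
      simp [hreal, ← Complex.ofReal_pow]
    have h2 : |s| * ‖x‖ ^ 2 ≤ ‖x‖ * ‖y - (s * Complex.I) • x‖ := by
      calc |s| * ‖x‖ ^ 2 = |(inner ℂ x (y - (s * Complex.I) • x)).im| := by
            rw [h1, abs_neg, abs_mul, abs_of_nonneg (sq_nonneg ‖x‖)]
        _ ≤ ‖inner ℂ x (y - (s * Complex.I) • x)‖ := Complex.abs_im_le_norm _
        _ ≤ _ := norm_inner_le_norm _ _
    rcases eq_or_lt_of_le (norm_nonneg x) with h0 | h0
    · rw [← h0, mul_zero]; exact norm_nonneg _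
    · refine le_of_mul_le_mul_left ?_ h0
      calc ‖x‖ * (|s| * ‖x‖) = |s| * ‖x‖ ^ 2 := by ring
        _ ≤ _ := h2
  refine exists_isResolvent_of_isSelfAdjoint hA (abs_pos.2 ht) (key t) fun x y hxy => ?_
  have := key (-t) x y hxy
  rw [abs_neg] at this
  convert this using 4
  simp

/-! ### Stone's theorem -/

theorem tendsto_clm_of_dense {ι : Type*} {l : Filter ι} {T : ι → H →L[ℂ] H} {T' : H →L[ℂ] H} {C : ℝ}
    (hC : ∀ i x, ‖T i x‖ ≤ C * ‖x‖) {S : Set H} (hS : Dense S)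
    (h : ∀ x ∈ S, Tendsto (fun i => T i x) l (𝓝 (T' x))) (x : H) :
    Tendsto (fun i => T i x) l (𝓝 (T' x)) := by
  rw [Metric.tendsto_nhds]
  intro ε hε
  obtain ⟨y, hy, hxy⟩ := Metric.dense_iff.1 hS x (ε / (2 * (|C| + ‖T'‖ + 1))) (by positivity)
  have hxy' : ‖x - y‖ < ε / (2 * (|C| + ‖T'‖ + 1)) := by
    rw [← dist_eq_norm, dist_comm]; exact hy
  rw [lt_div_iff₀ (by positivity)] at hxy'
  have h1 := Metric.tendsto_nhds.1 (h y hxy) (ε / 2) (by positivity)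
  filter_upwards [h1] with i hi
  rw [dist_eq_norm] at hi ⊢
  have h2 : T i x - T' x = T i (x - y) + (T i y - T' y) - T' (x - y) := by
    rw [map_sub, map_sub]; abel
  have h3 := hC i (x - y)
  have h4 := T'.le_opNorm (x - y)
  have h5 : C * ‖x - y‖ ≤ |C| * ‖x - y‖ := by gcongr; exact le_abs_self C
  calc ‖T i x - T' x‖ ≤ ‖T i (x - y)‖ + ‖T i y - T' y‖ + ‖T' (x - y)‖ := by
        rw [h2]; exact (norm_sub_le _ _).trans (by gcongr; exact norm_add_le _ _)
    _ < ε := by nlinarith [norm_nonneg (x - y)]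

/-- Bounded commuting self-adjoint operators that approximate a self-adjoint operator. -/
theorem exists_yosida {A : H →ₗ.[ℂ] H} (hA : IsSelfAdjoint A) :
    ∃ B : ℕ → H →L[ℂ] H, (∀ n, IsSelfAdjoint (B n)) ∧ (∀ m n, Commute (B m) (B n)) ∧
      ∀ x y, (x, y) ∈ A.graph → Tendsto (fun n => B n x) atTop (𝓝 y) := by
  have hp : ∀ n : ℕ, ((n : ℝ) + 1) ≠ 0 := fun n => by positivity
  have hq : ∀ n : ℕ, -((n : ℝ) + 1) ≠ 0 := fun n => neg_ne_zero.2 (hp n)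
  choose R hR hRb using fun n => exists_isResolvent_I_mul hA (hp n)
  choose S hS hSb using fun n => exists_isResolvent_I_mul hA (hq n)
  have habs : ∀ n : ℕ, |(n : ℝ) + 1| = n + 1 := fun n => abs_of_pos (by positivity)
  simp only [abs_neg, habs] at hRb hSb
  have hadj : ∀ n g h, inner ℂ (R n g) h = inner ℂ g (S n h) := by
    intro n g h
    have h1 := inner_graph_of_isSelfAdjoint hA ((hR n).mem_graph g) ((hS n).mem_graph h)
    rw [inner_add_left, inner_add_right, inner_smul_left, inner_smul_right] at h1
    simp only [map_mul, Complex.conj_ofReal, Complex.conj_I] at h1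
    push_cast at h1
    linear_combination -h1
  -- With `q = n + 1` this is `q² (A² + q²)⁻¹`, which tends strongly to `1`. The approximant chosen
  -- below is `q² A (A² + q²)⁻¹`, equal to `K n A` on `D(A)`.
  set K : ℕ → H →L[ℂ] H := fun n =>
    (((n : ℂ) + 1) * Complex.I / 2) • (S n - R n) with hK
  have hKb : ∀ n x, ‖K n x‖ ≤ 1 * ‖x‖ := by
    intro n x
    have h1 : ‖((n : ℂ) + 1) * Complex.I / 2‖ = (n + 1) / 2 := by
      have : ((n : ℂ) + 1) = (((n : ℝ) + 1 : ℝ) : ℂ) := by push_cast; rfl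
      rw [this, norm_div, norm_mul, Complex.norm_real, Complex.norm_I, Real.norm_eq_abs, habs]
      simp
    have h2 : K n x = (((n : ℂ) + 1) * Complex.I / 2) • (S n x - R n x) := rfl
    rw [h2, norm_smul, h1]
    have h3 := norm_sub_le (S n x) (R n x)
    have h4 := hRb n x
    have h5 := hSb n x
    have h6 : (0 : ℝ) < (n : ℝ) + 1 := by positivity
    nlinarith
  have hKR : ∀ n x y, (x, y) ∈ A.graph → K n x = x + (1 / 2 : ℂ) • -(S n y + R n y) := by
    intro n x y hxy
    have h1 := (hR n).apply_sub x y hxy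
    have h2 := (hS n).apply_sub x y hxy
    rw [map_sub, map_smul, sub_eq_iff_eq_add] at h1 h2
    have h3 : K n x = (((n : ℂ) + 1) * Complex.I / 2) • (S n x - R n x) := rfl
    rw [h3, h1, h2]
    push_cast
    module
  have hKt : ∀ x, Tendsto (fun n => K n x) atTop (𝓝 x) := by
    refine tendsto_clm_of_dense (T' := ContinuousLinearMap.id ℂ H) hKb hA.dense_domain ?_
    intro x hx
    have hxy := A.mem_graph ⟨x, hx⟩
    set y := A ⟨x, hx⟩
    have h0 : ∀ {Q : ℕ → H →L[ℂ] H}, (∀ (n : ℕ) h, ((n : ℝ) + 1) * ‖Q n h‖ ≤ ‖h‖) →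
        Tendsto (fun n => Q n y) atTop (𝓝 0) := by
      intro Q hQ
      refine squeeze_zero_norm (a := fun n : ℕ => ‖y‖ * (1 / ((n : ℝ) + 1))) (fun n => ?_) ?_
      · rw [mul_one_div, le_div_iff₀ (by positivity), mul_comm]
        exact hQ n y
      · simpa using tendsto_one_div_add_atTop_nhds_zero_nat.const_mul ‖y‖
    have h1 := ((((h0 hSb).add (h0 hRb)).neg).const_smul (1 / 2 : ℂ)).const_add x
    simp only [add_zero, neg_zero, smul_zero] at h1
    exact h1.congr fun n => (hKR n x y hxy).symm
  refine ⟨fun n => (((((n : ℝ) + 1) ^ 2 / 2 : ℝ)) : ℂ) • (R n + S n), fun n => ?_, fun m n => ?_,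
    fun x y hxy => ?_⟩
  · rw [ContinuousLinearMap.isSelfAdjoint_iff_isSymmetric]
    intro g h
    have h1 : inner ℂ (S n g) h = inner ℂ g (R n h) := by
      rw [← inner_conj_symm, ← hadj, inner_conj_symm]
    simp only [ContinuousLinearMap.coe_coe, smul_apply,
      add_apply, inner_smul_left, inner_smul_right, inner_add_left,
      inner_add_right, Complex.conj_ofReal, hadj, h1]
    ring
  · refine Commute.smul_left (Commute.smul_right ?_ _) _
    exact ((show Commute (R m) (R n) from (hR m).comm (hR n)).add_right ((hR m).comm (hS n))).add_left
      ((show Commute (S m) (R n) from (hS m).comm (hR n)).add_right ((hS m).comm (hS n)))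
  · refine (hKt y).congr fun n => ?_
    have h1 := (hR n).apply_sub x y hxy
    have h2 := (hS n).apply_sub x y hxy
    rw [map_sub, map_smul, sub_eq_iff_eq_add] at h1 h2
    have h3 : K n y = (((n : ℂ) + 1) * Complex.I / 2) • (S n y - R n y) := rfl
    rw [h3, h1, h2]
    simp only [smul_apply, add_apply]
    push_cast
    match_scalars
    · ring
    · linear_combination (-((n : ℂ) + 1) ^ 2 / 2) * Complex.I_sq
    · linear_combination (-((n : ℂ) + 1) ^ 2 / 2) * Complex.I_sq

/-- The unitary group of a bounded self-adjoint operator. -/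
def expGroup (B : H →L[ℂ] H) (t : ℝ) : H →L[ℂ] H := NormedSpace.exp (t • (Complex.I • B))

theorem hasDerivAt_expGroup (B : H →L[ℂ] H) (x : H) (t : ℝ) :
    HasDerivAt (fun s => expGroup B s x) (expGroup B t (Complex.I • B x)) t := by
  have h := hasDerivAt_exp_smul_const (𝕂 := ℝ) (Complex.I • B) t
  exact ((ContinuousLinearMap.apply ℂ H x).restrictScalars ℝ).hasFDerivAt.comp_hasDerivAt t h

theorem norm_expGroup {B : H →L[ℂ] H} (hB : IsSelfAdjoint B) (t : ℝ) (x : H) :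
    ‖expGroup B t x‖ = ‖x‖ := by
  let _ := NormedAlgebra.restrictScalars ℚ ℂ (H →L[ℂ] H)
  have h1 : expGroup B t ∈ unitary (H →L[ℂ] H) := by
    refine NormedSpace.exp_mem_unitary_of_mem_skewAdjoint ?_
    rw [skewAdjoint.mem_iff, star_smul, star_smul, hB.star_eq]
    simp
  exact ContinuousLinearMap.norm_map_of_mem_unitary h1 x

theorem norm_expGroup_sub_le {B : H →L[ℂ] H} (hB : IsSelfAdjoint B) (t : ℝ) (x : H) :
    ‖expGroup B t x - x‖ ≤ |t| * ‖B x‖ := by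
  have h := Convex.norm_image_sub_le_of_norm_hasDerivWithin_le (f := fun s => expGroup B s x)
    (f' := fun s => expGroup B s (Complex.I • B x)) (C := ‖B x‖) (s := Set.univ) (x := 0) (y := t)
    (fun s _ => (hasDerivAt_expGroup B x s).hasDerivWithinAt)
    (fun s _ => by rw [norm_expGroup hB, norm_smul, Complex.norm_I, one_mul]) convex_univ
    (Set.mem_univ _) (Set.mem_univ _)
  simpa [expGroup, mul_comm] using h

/-- Only `B x` and `B y` enter, never `‖B‖` or `B (B x)`. For Yosida approximants of `A`, with `x, y
∈ D(A)` and `y` near `A x`, the bound survives the limit and gives differentiability at `0`. -/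
theorem norm_expGroup_sub_sub_le {B : H →L[ℂ] H} (hB : IsSelfAdjoint B) (t : ℝ) (x y : H) :
    ‖expGroup B t x - x - t • (Complex.I • B x)‖ ≤ |t| * (|t| * ‖B y‖ + 2 * ‖B x - y‖) := by
  have hd : ∀ s : ℝ, HasDerivAt (fun s : ℝ => expGroup B s x - x - s • (Complex.I • B x))
      (expGroup B s (Complex.I • B x) - Complex.I • B x) s := fun s => by
    have h := ((hasDerivAt_expGroup B x s).sub_const x).sub
      ((hasDerivAt_id s).smul_const (Complex.I • B x))
    rw [one_smul] at h
    exact h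
  have hb : ∀ s ∈ Set.uIcc 0 t, ‖expGroup B s (Complex.I • B x) - Complex.I • B x‖ ≤
      |t| * ‖B y‖ + 2 * ‖B x - y‖ := by
    intro s hs
    have hst : |s| ≤ |t| := by
      have := Set.abs_sub_left_of_mem_uIcc hs
      simpa using this
    have h1 : expGroup B s (Complex.I • B x) - Complex.I • B x =
        Complex.I • (expGroup B s (B x - y) + (expGroup B s y - y) - (B x - y)) := by
      rw [map_smul, map_sub, ← smul_sub]; congr 1; abel
    rw [h1, norm_smul, Complex.norm_I, one_mul]
    have h2 := norm_expGroup_sub_le hB s y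
    have h3 := norm_expGroup hB s (B x - y)
    have h4 := norm_sub_le (expGroup B s (B x - y) + (expGroup B s y - y)) (B x - y)
    have h5 := norm_add_le (expGroup B s (B x - y)) (expGroup B s y - y)
    have h6 : |s| * ‖B y‖ ≤ |t| * ‖B y‖ := by gcongr
    linarith
  have h := Convex.norm_image_sub_le_of_norm_hasDerivWithin_le
    (fun s _ => (hd s).hasDerivWithinAt) hb (convex_uIcc 0 t) Set.left_mem_uIcc Set.right_mem_uIcc
  simpa [expGroup, mul_comm] using h

theorem expGroup_add (B : H →L[ℂ] H) (s t : ℝ) :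
    expGroup B (s + t) = expGroup B s * expGroup B t := by
  let _ := NormedAlgebra.restrictScalars ℚ ℂ (H →L[ℂ] H)
  rw [expGroup, add_smul]
  exact NormedSpace.exp_add_of_commute (((Commute.refl _).smul_left s).smul_right t)

/-- By commutativity, `e^{itB} = e^{itC} e^{it(B - C)}`, and the first factor is isometric. -/
theorem norm_expGroup_sub_expGroup_le {B C : H →L[ℂ] H} (hB : IsSelfAdjoint B)
    (hC : IsSelfAdjoint C) (hBC : Commute B C) (t : ℝ) (x : H) :
    ‖expGroup B t x - expGroup C t x‖ ≤ |t| * ‖B x - C x‖ := by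
  let _ := NormedAlgebra.restrictScalars ℚ ℂ (H →L[ℂ] H)
  have h1 : expGroup B t = expGroup C t * expGroup (B - C) t := by
    rw [expGroup, expGroup, expGroup, ← NormedSpace.exp_add_of_commute]
    · rw [← smul_add, ← smul_add, add_sub_cancel]
    · exact ((((hBC.symm.sub_right (Commute.refl C)).smul_left _).smul_right _).smul_left _).smul_right _
  rw [h1, mul_apply_eq_comp, ← map_sub, norm_expGroup hC]
  exact norm_expGroup_sub_le (hB.sub hC) t x

/-- Stone's theorem: every self-adjoint operator generates a unitary group. -/
theorem exists_isUnitaryGroupOf {A : H →ₗ.[ℂ] H} (hA : IsSelfAdjoint A) :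
    ∃ U : ℝ → H →L[ℂ] H, IsUnitaryGroupOf A U := by
  obtain ⟨B, hB, hBc, hBt⟩ := exists_yosida hA
  have hcauchy : ∀ t x, CauchySeq fun n => expGroup (B n) t x := by
    intro t x
    rw [Metric.cauchySeq_iff]
    intro ε hε
    obtain ⟨y, hy, hyd⟩ := Metric.dense_iff.1 hA.dense_domain x (ε / 4) (by positivity)
    have hc : CauchySeq fun n => B n y := (hBt y _ (A.mem_graph ⟨y, hyd⟩)).cauchySeq
    obtain ⟨N, hN⟩ := Metric.cauchySeq_iff.1 hc (ε / (2 * (|t| + 1))) (by positivity)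
    refine ⟨N, fun m hm n hn => ?_⟩
    have h1 := hN m hm n hn
    rw [dist_eq_norm, lt_div_iff₀ (by positivity)] at h1
    have h2 : ‖x - y‖ < ε / 4 := by rw [← dist_eq_norm, dist_comm]; exact hy
    have h3 := norm_expGroup_sub_expGroup_le (hB m) (hB n) (hBc m n) t y
    have h4 : expGroup (B m) t x - expGroup (B n) t x = expGroup (B m) t (x - y) +
        (expGroup (B m) t y - expGroup (B n) t y) - expGroup (B n) t (x - y) := by
      rw [map_sub, map_sub]; abel
    have h5 := norm_sub_le (expGroup (B m) t (x - y) +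
        (expGroup (B m) t y - expGroup (B n) t y)) (expGroup (B n) t (x - y))
    have h6 := norm_add_le (expGroup (B m) t (x - y)) (expGroup (B m) t y - expGroup (B n) t y)
    rw [norm_expGroup (hB _)] at h5 h6
    rw [dist_eq_norm, h4]
    nlinarith [norm_nonneg (B m y - B n y)]
  choose u hu using fun t x => cauchySeq_tendsto_of_complete (hcauchy t x)
  have hnorm : ∀ t x, ‖u t x‖ = ‖x‖ := fun t x =>
    tendsto_nhds_unique (hu t x).norm (by simp only [norm_expGroup (hB _)]; exact tendsto_const_nhds)
  let U : ℝ → H →L[ℂ] H := fun t => LinearMap.mkContinuous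
    { toFun := u t
      map_add' := fun x y => tendsto_nhds_unique (hu t (x + y)) (by
        simpa only [map_add] using (hu t x).add (hu t y))
      map_smul' := fun c x => tendsto_nhds_unique (hu t (c • x)) (by
        simpa only [map_smul, RingHom.id_apply] using (hu t x).const_smul c) } 1
    (fun x => by rw [one_mul]; exact (hnorm t x).le)
  have hU : ∀ t x, Tendsto (fun n => expGroup (B n) t x) atTop (𝓝 (U t x)) := hu
  have hUn : ∀ t x, ‖U t x‖ = ‖x‖ := hnorm
  have hadd : ∀ s t x, U (s + t) x = U s (U t x) := by
    intro s t x
    refine tendsto_nhds_unique (hU (s + t) x) ?_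
    have h1 : Tendsto (fun n => expGroup (B n) s (expGroup (B n) t x - U t x)) atTop (𝓝 0) := by
      rw [tendsto_zero_iff_norm_tendsto_zero]
      simp only [norm_expGroup (hB _)]
      rw [← tendsto_zero_iff_norm_tendsto_zero]
      exact tendsto_sub_nhds_zero_iff.2 (hU t x)
    have h2 := h1.add (hU s (U t x))
    rw [zero_add] at h2
    refine h2.congr fun n => ?_
    rw [← map_add, sub_add_cancel, expGroup_add, mul_apply_eq_comp]
  have hzero : ∀ x, U 0 x = x := fun x =>
    tendsto_nhds_unique (hU 0 x) (by simp [expGroup])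
  have hder : ∀ x y, (x, y) ∈ A.graph → HasDerivAt (fun t => U t x) (Complex.I • y) 0 := by
    intro x y hxy
    rw [hasDerivAt_iff_isLittleO, Asymptotics.isLittleO_iff]
    intro ε hε
    obtain ⟨z, hz, hzd⟩ := Metric.dense_iff.1 hA.dense_domain y (ε / 4) (by positivity)
    have hz' : ‖y - z‖ < ε / 4 := by rw [← dist_eq_norm, dist_comm]; exact hz
    set w := A ⟨z, hzd⟩
    have hest : ∀ t : ℝ, ‖U t x - x - t • (Complex.I • y)‖ ≤ |t| * (|t| * ‖w‖ + 2 * ‖y - z‖) := by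
      intro t
      have hBx := hBt x y hxy
      refine le_of_tendsto_of_tendsto
        (((hU t x).sub_const x).sub ((hBx.const_smul Complex.I).const_smul t)).norm
        ((((hBt z w (A.mem_graph ⟨z, hzd⟩)).norm.const_mul |t|).add
          ((hBx.sub_const z).norm.const_mul 2)).const_mul |t|)
        (Eventually.of_forall fun n => norm_expGroup_sub_sub_le (hB n) t x z)
    have hsmall : ∀ᶠ t : ℝ in 𝓝 0, |t| * ‖w‖ < ε / 2 := by
      have : Tendsto (fun t : ℝ => |t| * ‖w‖) (𝓝 0) (𝓝 (|0| * ‖w‖)) :=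
        (continuous_abs.mul continuous_const).tendsto 0
      rw [abs_zero, zero_mul] at this
      exact this.eventually_lt_const (by positivity)
    filter_upwards [hsmall] with t ht
    rw [hzero, sub_zero, Real.norm_eq_abs]
    refine (hest t).trans ?_
    rw [mul_comm]
    gcongr
    linarith
  refine ⟨U, ⟨ContinuousLinearMap.ext hzero, fun s t => ContinuousLinearMap.ext (hadd s t), hUn,
    fun x => ?_, fun x y => ⟨fun h => ?_, ?_⟩⟩⟩
  · have h0 : Tendsto (fun t => U t x) (𝓝 0) (𝓝 x) := by
      refine tendsto_clm_of_dense (T := U) (T' := ContinuousLinearMap.id ℂ H) (C := 1)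
        (fun t y => by rw [hUn, one_mul]) hA.dense_domain (fun y hy => ?_) x
      have := (hder y _ (A.mem_graph ⟨y, hy⟩)).continuousAt.tendsto
      rwa [hzero] at this
    rw [continuous_iff_continuousAt]
    intro t
    have h1 : Tendsto (fun s => U t (U (s - t) x)) (𝓝 t) (𝓝 (U t x)) := by
      refine ((U t).continuous.tendsto x).comp (h0.comp ?_)
      have : Tendsto (fun s : ℝ => s - t) (𝓝 t) (𝓝 (t - t)) :=
        (continuous_sub_right t).tendsto t
      rwa [sub_self] at this
    refine h1.congr fun s => ?_
    rw [← hadd, add_sub_cancel]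
  -- Differentiating the constant `⟪U t x, U t a⟫` for `a ∈ D(A)` shows that `x` lies in the domain
  -- of the adjoint of `A`, which is `A`.
  · have hmem : (x, (-Complex.I) • y) ∈ A.graph := by
      refine mem_graph_of_isSelfAdjoint hA fun a b hab => ?_
      have h1 : HasDerivAt (fun t => inner ℂ (U t x) (U t a)) _ 0 := h.inner ℂ (hder a b hab)
      have h2 : (fun t => inner ℂ (U t x) (U t a)) = fun _ => inner ℂ x a := by
        funext t
        exact (LinearMap.norm_map_iff_inner_map_map (U t)).1 (hUn t) x a
      rw [h2] at h1
      have h3 := h1.unique (hasDerivAt_const (0 : ℝ) (inner ℂ x a))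
      rw [hzero, hzero, inner_smul_right] at h3
      rw [inner_smul_left, map_neg, Complex.conj_I]
      linear_combination Complex.I * h3 - inner ℂ x b * Complex.I_sq
    have hx := LinearPMap.mem_domain_of_mem_graph hmem
    have h4 := (LinearPMap.image_iff hx).2 hmem
    refine ⟨hx, ?_⟩
    rw [← h4, smul_smul]
    simp
  · rintro ⟨hx, rfl⟩
    exact hder x _ (A.mem_graph ⟨x, hx⟩)

theorem isUnitaryGroupOf_unitaryGroup {A : H →ₗ.[ℂ] H} (hA : IsSelfAdjoint A) :
    IsUnitaryGroupOf A (unitaryGroup A) := by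
  have h := exists_isUnitaryGroupOf hA
  rw [unitaryGroup, dif_pos h]
  exact h.choose_spec

namespace IsUnitaryGroupOf
variable {A : H →ₗ.[ℂ] H} {U : ℝ → H →L[ℂ] H}

theorem add_apply (hU : IsUnitaryGroupOf A U) (s t : ℝ) (x : H) : U (s + t) x = U s (U t x) := by
  rw [hU.map_add]; rfl

theorem mem_graph_apply (hU : IsUnitaryGroupOf A U) {x y : H} (hxy : (x, y) ∈ A.graph) (t : ℝ) :
    (U t x, U t y) ∈ A.graph := by
  obtain ⟨a, rfl, rfl⟩ := (LinearPMap.mem_graph_iff _).1 hxy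
  have h0 : HasDerivAt (fun s => U s (a : H)) (Complex.I • A a) 0 :=
    (hU.generator _ _).2 ⟨a.2, rfl⟩
  have h1 : HasDerivAt (fun s => U t (U s (a : H))) (U t (Complex.I • A a)) 0 :=
    (((U t).restrictScalars ℝ).hasFDerivAt).comp_hasDerivAt (0 : ℝ) h0
  have h2 : (fun s => U t (U s (a : H))) = fun s => U s (U t (a : H)) := by
    funext s
    rw [← hU.add_apply, ← hU.add_apply, add_comm]
  rw [h2] at h1
  obtain ⟨h, he⟩ := (hU.generator _ _).1 h1
  rw [map_smul] at he
  have h3 : U t (A a) = A ⟨U t a, h⟩ := smul_right_injective H Complex.I_ne_zero he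
  rw [LinearPMap.mem_graph_iff]
  exact ⟨⟨U t a, h⟩, rfl, h3.symm⟩

theorem hasDerivAt (hU : IsUnitaryGroupOf A U) {x y : H} (hxy : (x, y) ∈ A.graph) (t : ℝ) :
    HasDerivAt (fun s => U s x) (Complex.I • U t y) t := by
  obtain ⟨a, rfl, rfl⟩ := (LinearPMap.mem_graph_iff _).1 hxy
  have h0 : HasDerivAt (fun s => U s (a : H)) (Complex.I • A a) (t - t) := by
    rw [sub_self]
    exact (hU.generator _ _).2 ⟨a.2, rfl⟩
  have h1 : HasDerivAt (fun s => U (s - t) (a : H)) (Complex.I • A a) t := by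
    simpa using h0.comp_sub_const t t
  have h2 : HasDerivAt (fun s => U t (U (s - t) (a : H))) (U t (Complex.I • A a)) t :=
    (((U t).restrictScalars ℝ).hasFDerivAt).comp_hasDerivAt t h1
  rw [map_smul] at h2
  refine h2.congr_of_eventuallyEq (Eventually.of_forall fun s => ?_)
  dsimp only
  rw [← hU.add_apply, add_sub_cancel]

theorem inner_map_map (hU : IsUnitaryGroupOf A U) (t : ℝ) (x y : H) : inner ℂ (U t x) (U t y) = inner ℂ x y :=
  (LinearMap.norm_map_iff_inner_map_map (U t)).1 (hU.norm_map t) x y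

theorem inner_map_left (hU : IsUnitaryGroupOf A U) (t : ℝ) (x y : H) : inner ℂ (U t x) y = inner ℂ x (U (-t) y) := by
  rw [← hU.inner_map_map t x, ← hU.add_apply, add_neg_cancel, hU.map_zero]; rfl

end IsUnitaryGroupOf

/-! ### A Fejér-type estimate for unitary operators -/

/-- The double sum is `|∑ e^{ikθ}|²`, a multiple of the Fejér kernel. -/
theorem sum_sum_cos_nonneg (M : ℕ) (θ : ℝ) :
    0 ≤ ∑ j ∈ Finset.range M, ∑ k ∈ Finset.range M, Real.cos (((k : ℝ) - j) * θ) := by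
  have : ∑ j ∈ Finset.range M, ∑ k ∈ Finset.range M, Real.cos (((k : ℝ) - j) * θ) =
      (∑ k ∈ Finset.range M, Real.cos (k * θ)) ^ 2 + (∑ k ∈ Finset.range M, Real.sin (k * θ)) ^ 2 := by
    rw [sq, sq, Finset.sum_mul_sum, Finset.sum_mul_sum, ← Finset.sum_add_distrib]
    refine Finset.sum_congr rfl fun j _ => ?_
    rw [← Finset.sum_add_distrib]
    refine Finset.sum_congr rfl fun k _ => ?_
    rw [sub_mul, Real.cos_sub]
    ring
  rw [this]
  positivity

/-- `∑_{j ≠ k} sin ((k - j) θ) / (k - j)`, summed over `j, k < M`. -/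
def sineSum (M : ℕ) (θ : ℝ) : ℝ :=
  ∑ j ∈ Finset.range M, ∑ k ∈ Finset.range M, ((k : ℝ) - j)⁻¹ * Real.sin (((k : ℝ) - j) * θ)

/-- The derivative is the full nonnegative cosine sum: `sineSum` supplies the terms `j ≠ k`, and `M
* θ` supplies the `M` diagonal ones, which `0⁻¹ = 0` removes from `sineSum`. -/
theorem monotone_sineSum_add (M : ℕ) : Monotone fun θ => sineSum M θ + M * θ := by
  have hd : ∀ θ, HasDerivAt (fun θ => sineSum M θ + M * θ)
      (∑ j ∈ Finset.range M, ∑ k ∈ Finset.range M, ((k : ℝ) - j)⁻¹ *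
        (Real.cos (((k : ℝ) - j) * θ) * (((k : ℝ) - j) * 1)) + M * 1) θ := by
    intro θ
    refine HasDerivAt.add ?_ ((hasDerivAt_id θ).const_mul _)
    refine HasDerivAt.fun_sum fun j _ => HasDerivAt.fun_sum fun k _ => ?_
    exact (((hasDerivAt_id θ).const_mul _).sin).const_mul _
  refine monotone_of_deriv_nonneg (fun θ => (hd θ).differentiableAt) fun θ => ?_
  rw [(hd θ).deriv]
  have h1 : ∀ j ∈ Finset.range M, ∑ k ∈ Finset.range M, Real.cos (((k : ℝ) - j) * θ) =
      ∑ k ∈ Finset.range M, ((k : ℝ) - j)⁻¹ *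
        (Real.cos (((k : ℝ) - j) * θ) * (((k : ℝ) - j) * 1)) + 1 := by
    intro j hj
    rw [← Finset.sum_erase_add _ _ hj, ← Finset.sum_erase_add (a := j) _ _ hj]
    simp only [sub_self, zero_mul, mul_zero, Real.cos_zero, add_zero]
    congr 1
    refine Finset.sum_congr rfl fun k hk => ?_
    have : (k : ℝ) - j ≠ 0 := sub_ne_zero.2 (by exact_mod_cast Finset.ne_of_mem_erase hk)
    field_simp
  have h2 := sum_sum_cos_nonneg M θ
  rw [Finset.sum_congr rfl h1, Finset.sum_add_distrib] at h2
  simpa using h2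

/-- The sine sum vanishes at `0` and `π`, so monotonicity traps `sineSum M θ + M θ` between `0` and
`M π`. Bounding the terms one by one would cost a factor `log M`. -/
theorem abs_sineSum_le_of_nonneg (M : ℕ) {θ : ℝ} (h0 : 0 ≤ θ) (hπ : θ ≤ Real.pi) :
    |sineSum M θ| ≤ M * Real.pi := by
  have h1 := monotone_sineSum_add M h0
  have h2 := monotone_sineSum_add M hπ
  have h3 : sineSum M 0 = 0 := by simp [sineSum]
  have h4 : sineSum M Real.pi = 0 := by
    refine Finset.sum_eq_zero fun j _ => Finset.sum_eq_zero fun k _ => ?_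
    have := Real.sin_int_mul_pi ((k : ℤ) - j)
    push_cast at this
    rw [this, mul_zero]
  dsimp only at h1 h2
  rw [h3] at h1
  rw [h4] at h2
  have h5 : (M : ℝ) * θ ≤ M * Real.pi := by gcongr
  have h6 : 0 ≤ (M : ℝ) * θ := by positivity
  rw [abs_le]
  constructor <;> linarith

theorem abs_sineSum_le (M : ℕ) {θ : ℝ} (hπ : |θ| ≤ Real.pi) : |sineSum M θ| ≤ M * Real.pi := by
  rcases le_total 0 θ with h | h
  · exact abs_sineSum_le_of_nonneg M h (by rwa [abs_of_nonneg h] at hπ)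
  · rw [abs_of_nonpos h] at hπ
    have h1 : sineSum M (-θ) = -sineSum M θ := by
      simp [sineSum, Finset.sum_neg_distrib]
    have := abs_sineSum_le_of_nonneg M (neg_nonneg.2 h) hπ
    rwa [h1, abs_neg] at this

/-- For `z = e^{iθ}` the cosine part is antisymmetric in `j, k` and cancels, leaving `i * sineSum M
θ`. -/
theorem norm_sum_star_pow_mul_pow_le (M : ℕ) {z : ℂ} (hz : ‖z‖ = 1) :
    ‖∑ j ∈ Finset.range M, ∑ k ∈ Finset.range M,
      (((k : ℝ) - j)⁻¹ : ℝ) * (star z ^ j * z ^ k)‖ ≤ M * Real.pi := by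
  have h1 : z = Complex.exp (z.arg * Complex.I) := by
    have := Complex.norm_mul_exp_arg_mul_I z
    rw [hz] at this
    simpa using this.symm
  set θ := z.arg
  have h2 : ∀ j k : ℕ, star z ^ j * z ^ k = Complex.exp ((((k : ℝ) - j) * θ : ℝ) * Complex.I) := by
    intro j k
    have h3 : star z = Complex.exp (-(θ * Complex.I)) := by
      conv_lhs => rw [h1]
      rw [Complex.star_def, ← Complex.exp_conj]
      simp
    rw [h3, h1, ← Complex.exp_nat_mul, ← Complex.exp_nat_mul, ← Complex.exp_add]
    congr 1
    push_cast
    ring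
  have h4 : ∑ j ∈ Finset.range M, ∑ k ∈ Finset.range M,
      ((((k : ℝ) - j)⁻¹ : ℝ) : ℂ) * (star z ^ j * z ^ k) = sineSum M θ * Complex.I := by
    apply Complex.ext
    · simp only [Complex.re_sum, h2, Complex.re_ofReal_mul, Complex.exp_ofReal_mul_I_re,
        Complex.I_re, mul_zero]
      have h5 : ∀ a : ℝ, a = -a → a = 0 := fun a h => by linarith
      apply h5
      rw [← Finset.sum_neg_distrib, Finset.sum_comm]
      refine Finset.sum_congr rfl fun j _ => ?_
      rw [← Finset.sum_neg_distrib]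
      refine Finset.sum_congr rfl fun k _ => ?_
      rw [← neg_sub (k : ℝ) j, inv_neg, neg_mul, neg_mul, Real.cos_neg]
    · simp only [Complex.im_sum, h2, Complex.im_ofReal_mul, Complex.exp_ofReal_mul_I_im,
        Complex.I_im, mul_one, sineSum]
  rw [h4, norm_mul, Complex.norm_I, mul_one, Complex.norm_real, Real.norm_eq_abs]
  exact abs_sineSum_le M (Complex.abs_arg_le_pi z)

/-- The scalar bound on the unit circle passes to `V` through the continuous functional calculus. -/
theorem norm_sum_star_pow_mul_pow_le_of_mem_unitary {V : H →L[ℂ] H}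
    (hV : V ∈ unitary (H →L[ℂ] H)) (M : ℕ) :
    ‖∑ j ∈ Finset.range M, ∑ k ∈ Finset.range M,
      ((((k : ℝ) - j)⁻¹ : ℝ) : ℂ) • (star V ^ j * V ^ k)‖ ≤ M * Real.pi := by
  have hn : IsStarNormal V := isStarNormal_of_mem_unitary hV
  have h1 : ∀ j k : ℕ, ((((k : ℝ) - j)⁻¹ : ℝ) : ℂ) • (star V ^ j * V ^ k) =
      cfc (fun z : ℂ => ((((k : ℝ) - j)⁻¹ : ℝ) : ℂ) * (star z ^ j * z ^ k)) V := by
    intro j k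
    rw [cfc_const_mul _ _ V, cfc_mul _ _ V, cfc_pow _ _ V, cfc_pow _ _ V, cfc_star_id V, cfc_id' ℂ V]
  have h2 : ∑ j ∈ Finset.range M, ∑ k ∈ Finset.range M,
      ((((k : ℝ) - j)⁻¹ : ℝ) : ℂ) • (star V ^ j * V ^ k) =
      cfc (fun z : ℂ => ∑ j ∈ Finset.range M, ∑ k ∈ Finset.range M,
        ((((k : ℝ) - j)⁻¹ : ℝ) : ℂ) * (star z ^ j * z ^ k)) V := by
    have h3 : ∀ j : ℕ, cfc (fun z : ℂ => ∑ k ∈ Finset.range M,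
        ((((k : ℝ) - j)⁻¹ : ℝ) : ℂ) * (star z ^ j * z ^ k)) V = ∑ k ∈ Finset.range M,
        ((((k : ℝ) - j)⁻¹ : ℝ) : ℂ) • (star V ^ j * V ^ k) := by
      intro j
      rw [Finset.sum_congr rfl fun k _ => h1 j k,
        ← cfc_sum (fun (k : ℕ) (z : ℂ) => ((((k : ℝ) - j)⁻¹ : ℝ) : ℂ) * (star z ^ j * z ^ k)) V _
          (fun k _ => by fun_prop), Finset.sum_fn]
    rw [← Finset.sum_congr rfl fun j _ => h3 j,
      ← cfc_sum (fun (j : ℕ) (z : ℂ) => ∑ k ∈ Finset.range M,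
        ((((k : ℝ) - j)⁻¹ : ℝ) : ℂ) * (star z ^ j * z ^ k)) V _
          (fun k _ => by fun_prop), Finset.sum_fn]
  rw [h2]
  refine norm_cfc_le (by positivity) fun z hz => norm_sum_star_pow_mul_pow_le M ?_
  simpa using spectrum.subset_circle_of_unitary hV hz

/-! ### The square root of a nonnegative operator -/

theorem IsOneAddInverse.mem_graph {T : H →ₗ.[ℂ] H} {R : H →L[ℂ] H} (hR : IsOneAddInverse T R)
    (h : H) : (R h, h - R h) ∈ T.graph := by
  obtain ⟨hm, he⟩ := hR.1 h
  exact (LinearPMap.image_iff hm).1 (sub_eq_iff_eq_add'.2 he.symm)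

/-- `‖T^{1/2} φ‖² = ⟪φ, T φ⟫` for `φ ∈ D(T)`. -/
theorem norm_rpow_half_sq {T : H →ₗ.[ℂ] H} (hT : ∃ R, IsOneAddInverse T R)
    (hsymm : ∀ x y u v, (x, y) ∈ T.graph → (u, v) ∈ T.graph → inner ℂ y u = inner ℂ x v)
    (hpos : ∀ x y, (x, y) ∈ T.graph → 0 ≤ (inner ℂ x y).re) {x y : H} (hxy : (x, y) ∈ T.graph)
    (hx : x ∈ (rpow T (1 / 2)).domain) :
    ‖rpow T (1 / 2) ⟨x, hx⟩‖ ^ 2 = (inner ℂ x y).re := by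
  have hR : IsOneAddInverse T (oneAddInv T) := by
    rw [oneAddInv, dif_pos hT]; exact hT.choose_spec
  set R := oneAddInv T with hRdef
  have hRs : ∀ g h, inner ℂ (R g) h = inner ℂ g (R h) := by
    intro g h
    have := hsymm _ _ _ _ (hR.mem_graph g) (hR.mem_graph h)
    rw [inner_sub_left, inner_sub_right] at this
    linear_combination -this
  have hRsa : IsSelfAdjoint R := by
    rw [ContinuousLinearMap.isSelfAdjoint_iff_isSymmetric]
    exact hRs
  have hR0 : 0 ≤ R := by
    rw [ContinuousLinearMap.nonneg_iff_isPositive]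
    refine ⟨hRs, fun g => ?_⟩
    have h1 := hpos _ _ (hR.mem_graph g)
    rw [inner_sub_right, Complex.sub_re] at h1
    have h2 : (inner ℂ (R g) (R g)).re = ‖R g‖ ^ 2 := by
      simp [inner_self_eq_norm_sq_to_K, ← Complex.ofReal_pow]
    change 0 ≤ (inner ℂ (R g) g).re
    nlinarith [sq_nonneg ‖R g‖]
  have hR1 : R ≤ 1 := by
    rw [← sub_nonneg, ContinuousLinearMap.nonneg_iff_isPositive]
    refine ⟨((IsSelfAdjoint.one _).sub hRsa).isSymmetric, fun g => ?_⟩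
    have h1 := hpos _ _ (hR.mem_graph g)
    have h2 : (inner ℂ (g - R g) (g - R g)).re = ‖g - R g‖ ^ 2 := by
      simp [inner_self_eq_norm_sq_to_K, ← Complex.ofReal_pow]
    have h3 : inner ℂ (g - R g) g = inner ℂ (g - R g) (g - R g) + inner ℂ (g - R g) (R g) := by
      rw [← inner_add_right, sub_add_cancel]
    have h4 : (inner ℂ (g - R g) (R g)).re = (inner ℂ (R g) (g - R g)).re := by
      rw [← inner_conj_symm, Complex.conj_re]
    change 0 ≤ (inner ℂ (g - R g) g).re
    rw [h3, Complex.add_re, h2, h4]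
    positivity
  have hs0 : ∀ r ∈ spectrum ℝ R, 0 ≤ r := fun r hr => spectrum_nonneg_of_nonneg hR0 hr
  have hs1 : ∀ r ∈ spectrum ℝ R, r ≤ 1 :=
    (le_algebraMap_iff_spectrum_le (r := (1 : ℝ)) (a := R)).1 (by rwa [map_one])
  have hc1 : Continuous fun r : ℝ => r ^ (1 / 2 : ℝ) := Real.continuous_rpow_const (by norm_num)
  have hc2 : Continuous fun r : ℝ => (1 - r) ^ (1 / 2 : ℝ) :=
    hc1.comp (continuous_const.sub continuous_id)
  set S := cfc (fun r : ℝ => r ^ (1 / 2 : ℝ)) R with hS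
  set S' := cfc (fun r : ℝ => (1 - r) ^ (1 / 2 : ℝ)) R with hS'
  have hSS : S * S = R := by
    rw [hS, ← cfc_mul _ _ R hc1.continuousOn hc1.continuousOn]
    conv_rhs => rw [← cfc_id ℝ R]
    refine cfc_congr fun r hr => ?_
    have := hs0 r hr
    simp only [← Real.sqrt_eq_rpow, id, Real.mul_self_sqrt this]
  have hSS' : S' * S' = 1 - R := by
    rw [hS', ← cfc_mul _ _ R hc2.continuousOn hc2.continuousOn]
    conv_rhs => rw [← cfc_id' ℝ R, ← cfc_one ℝ R, ← cfc_sub _ _ R]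
    refine cfc_congr fun r hr => ?_
    have := hs1 r hr
    simp only [← Real.sqrt_eq_rpow, Real.mul_self_sqrt (sub_nonneg.2 this), Pi.one_apply]
  have hcomm : S * S' = S' * S := cfc_commute_cfc _ _ R
  have hSsa : ∀ g h, inner ℂ (S g) h = inner ℂ g (S h) :=
    (show IsSelfAdjoint S from cfc_predicate _ R).isSymmetric
  have hSsa' : ∀ g h, inner ℂ (S' g) h = inner ℂ g (S' h) :=
    (show IsSelfAdjoint S' from cfc_predicate _ R).isSymmetric
  -- Injectivity of `R^{1/2}` makes the kernel in the definition of `rpow` the graph of a function.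
  have hinj : ∀ h, S h = 0 → h = 0 := by
    intro h h0
    have h1 : R h = 0 := by rw [← hSS, mul_apply_eq_comp, h0, map_zero]
    have h2 := hR.mem_graph h
    rw [h1, sub_zero] at h2
    exact LinearPMap.graph_fst_eq_zero_snd _ h2 rfl
  have hmem : ∀ q : H × H, q ∈ LinearMap.ker (S.toLinearMap ∘ₗ LinearMap.snd ℂ H H -
      S'.toLinearMap ∘ₗ LinearMap.fst ℂ H H) ↔ S q.2 = S' q.1 := by
    intro q
    rw [LinearMap.mem_ker, LinearMap.sub_apply, sub_eq_zero]
    rfl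
  have hgr : (x, rpow T (1 / 2) ⟨x, hx⟩) ∈ LinearMap.ker (S.toLinearMap ∘ₗ LinearMap.snd ℂ H H -
      S'.toLinearMap ∘ₗ LinearMap.fst ℂ H H) := by
    refine Submodule.mem_graph_toLinearPMap ?_ ⟨x, hx⟩
    rintro ⟨a, b⟩ hab (rfl : a = 0)
    rw [hmem, map_zero] at hab
    exact hinj b hab
  rw [hmem] at hgr
  -- Since `x = R w` and `y = (1 - R) w`, the vector `T^{1/2} x` is `S' S w`, with squared norm `⟪R
  -- w, (1 - R) w⟫`.
  set w := x + y with hw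
  have hRw : R w = x := by
    obtain ⟨a, rfl, rfl⟩ := (LinearPMap.mem_graph_iff _).1 hxy
    exact hR.2 a
  have h5 : rpow T (1 / 2) ⟨x, hx⟩ = S' (S w) := by
    rw [← sub_eq_zero]
    refine hinj _ ?_
    dsimp only at hgr
    rw [map_sub, hgr, sub_eq_zero, ← hRw, ← hSS]
    change (S' * S) (S w) = (S * S') (S w)
    rw [hcomm]
  have h6 : inner ℂ (S' (S w)) (S' (S w)) = inner ℂ x y := by
    rw [hSsa', ← mul_apply_eq_comp, hSS', hSsa]
    have h7 : S ((1 - R) (S w)) = R y := by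
      change (S * ((1 - R) * S)) w = _
      have h8 : S * ((1 - R) * S) = R * (1 - R) := by
        rw [← hSS]; noncomm_ring
      rw [h8, mul_apply_eq_comp]
      congr 1
      change w - R w = y
      rw [hRw, hw, add_sub_cancel_left]
    rw [h7, ← hRs, hRw]
  rw [h5, ← h6, inner_self_eq_norm_sq_to_K]
  simp [← Complex.ofReal_pow]

/-! ### Operators relative to the reference operator -/

/-- `G` is the bounded inverse of the reference operator `Y`, expressed without `Y`: it is a
contraction, nonnegative in the strong form `‖G h‖² ≤ ⟪G h, h⟫`, and has dense range. -/
structure IsReferenceInverse (Y : H →ₗ.[ℂ] H) (𝒟 : Submodule ℂ H) (G : H →L[ℂ] H) : Prop where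
  mem_graph : ∀ h, (G h, h) ∈ Y.graph
  apply_eq : ∀ x y, (x, y) ∈ Y.graph → G y = x
  symm : ∀ g h, inner ℂ (G g) h = inner ℂ g (G h)
  sq_norm_le : ∀ h, ‖G h‖ ^ 2 ≤ (inner ℂ (G h) h).re
  dense : Dense {h | G h ∈ 𝒟}
  denseRange : Dense (Set.range G)
  exists_eq : ∀ φ ∈ 𝒟, ∃ h, G h = φ

/-- `Y ≥ 1` gives invertibility, and the core property becomes density of `{h | G h ∈ 𝒟}`. That
density lets continuous identities in `h` be checked on `𝒟` alone. -/
theorem IsReference.exists_inverse {Y : H →ₗ.[ℂ] H} {𝒟 : Submodule ℂ H} (hY : IsReference Y 𝒟) :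
    ∃ G : H →L[ℂ] H, IsReferenceInverse Y 𝒟 G := by
  have h1 : ∀ x y, (x, y) ∈ Y.graph → ‖x‖ ^ 2 ≤ (inner ℂ x y).re := by
    intro x y hxy
    obtain ⟨a, rfl, rfl⟩ := (LinearPMap.mem_graph_iff _).1 hxy
    exact hY.one_le a
  have h2 : ∀ x y, (x, y) ∈ Y.graph → 1 * ‖x‖ ≤ ‖y - (0 : ℂ) • x‖ := by
    intro x y hxy
    rw [zero_smul, sub_zero, one_mul]
    have h3 := h1 x y hxy
    have h4 : (inner ℂ x y).re ≤ ‖x‖ * ‖y‖ := (Complex.re_le_norm _).trans (norm_inner_le_norm _ _)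
    rcases eq_or_lt_of_le (norm_nonneg x) with h0 | h0
    · rw [← h0]; exact norm_nonneg _
    · exact le_of_mul_le_mul_left (by nlinarith) h0
  obtain ⟨G, hG, -⟩ := exists_isResolvent_of_isSelfAdjoint hY.selfAdjoint one_pos h2
    (by simpa using h2)
  have hm : ∀ h, (G h, h) ∈ Y.graph := fun h => by simpa using hG.mem_graph h
  have ha : ∀ x y, (x, y) ∈ Y.graph → G y = x := fun x y hxy => by simpa using hG.apply_sub x y hxy
  refine ⟨G, hm, ha, fun g h => ?_, fun h => h1 _ _ (hm h), fun h => ?_, ?_,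
    fun φ hφ => ⟨Y ⟨φ, hY.core.le_domain hφ⟩, ha _ _ (Y.mem_graph ⟨φ, hY.core.le_domain hφ⟩)⟩⟩
  · exact (inner_graph_of_isSelfAdjoint hY.selfAdjoint (hm g) (hm h)).symm
  · have hcl : (Y.domRestrict 𝒟).IsClosable :=
      hY.selfAdjoint.isClosed.isClosable.leIsClosable Y.domRestrict_le
    have h3 : (G h, h) ∈ (Y.domRestrict 𝒟).graph.topologicalClosure := by
      rw [hcl.graph_closure_eq_closure_graph, hY.core.closure_eq]
      exact hm h
    have h4 : (G h, h) ∈ closure ((Y.domRestrict 𝒟).graph : Set (H × H)) := h3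
    have h5 := image_closure_subset_closure_image continuous_snd ⟨_, h4, rfl⟩
    refine closure_mono ?_ h5
    rintro _ ⟨⟨x, y⟩, hxy, rfl⟩
    obtain ⟨a, rfl, rfl⟩ := (LinearPMap.mem_graph_iff _).1 hxy
    have h6 := LinearPMap.le_graph_of_le Y.domRestrict_le hxy
    change G _ ∈ 𝒟
    rw [ha _ _ h6]
    exact a.2.1
  · refine hY.selfAdjoint.dense_domain.mono fun x hx => ?_
    exact ⟨Y ⟨x, hx⟩, ha _ _ (Y.mem_graph ⟨x, hx⟩)⟩

namespace IsReferenceInverse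
variable {Y : H →ₗ.[ℂ] H} {𝒟 : Submodule ℂ H} {G : H →L[ℂ] H}

theorem inner_im (hG : IsReferenceInverse Y 𝒟 G) (h : H) : (inner ℂ (G h) h).im = 0 := by
  rw [← Complex.conj_eq_iff_im, inner_conj_symm, hG.symm]

theorem inner_re_nonneg (hG : IsReferenceInverse Y 𝒟 G) (h : H) : 0 ≤ (inner ℂ (G h) h).re :=
  (sq_nonneg _).trans (hG.sq_norm_le h)

theorem dense_domain (hG : IsReferenceInverse Y 𝒟 G) : Dense (𝒟 : Set H) := by
  have h1 := DenseRange.dense_image hG.denseRange G.continuous hG.dense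
  refine h1.mono ?_
  rintro _ ⟨h, hh, rfl⟩
  exact hh

theorem injective (hG : IsReferenceInverse Y 𝒟 G) : Function.Injective G := by
  refine (injective_iff_map_eq_zero G).2 fun h h0 => ?_
  have := hG.mem_graph h
  rw [h0] at this
  exact LinearPMap.graph_fst_eq_zero_snd _ this rfl

end IsReferenceInverse

/-- `Z` is the bounded operator `X Y⁻¹`, where `G = Y⁻¹`. -/
structure IsRelativization {𝒟 : Submodule ℂ H} (G : H →L[ℂ] H) (X : 𝒟 →ₗ[ℂ] H) (Z : H →L[ℂ] H) :
    Prop where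
  apply_eq : ∀ h (hh : G h ∈ 𝒟), Z h = X ⟨G h, hh⟩
  mem_graph : ∀ h, (G h, Z h) ∈ (closedOp X).graph
  symm : ∀ g h, inner ℂ (Z g) (G h) = inner ℂ (G g) (Z h)
  form_bound : ∃ k : ℝ, 0 ≤ k ∧ ∀ h, |(inner ℂ h (Z h)).im| ≤ k * (inner ℂ (G h) h).re

theorem isClosable_of_isSymmetricOn {𝒟 : Submodule ℂ H} {X : 𝒟 →ₗ[ℂ] H} (h𝒟 : Dense (𝒟 : Set H))
    (hX : IsSymmetricOn X) : (LinearPMap.mk 𝒟 X).IsClosable := by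
  rw [LinearPMap.isClosable_iff_exists_closed_extension]
  refine ⟨(LinearPMap.mk 𝒟 X).adjoint, LinearPMap.adjoint_isClosed h𝒟, ?_⟩
  exact LinearPMap.IsFormalAdjoint.le_adjoint (T := LinearPMap.mk 𝒟 X) h𝒟 fun x y => hX x y

theorem mem_graph_closedOp_iff {𝒟 : Submodule ℂ H} {X : 𝒟 →ₗ[ℂ] H} (h𝒟 : Dense (𝒟 : Set H))
    (hX : IsSymmetricOn X) (p : H × H) :
    p ∈ (closedOp X).graph ↔ p ∈ closure (Set.range fun φ : 𝒟 => ((φ : H), X φ)) := by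
  rw [closedOp, ← (isClosable_of_isSymmetricOn h𝒟 hX).graph_closure_eq_closure_graph]
  have : ((LinearPMap.mk 𝒟 X).graph : Set (H × H)) = Set.range fun φ : 𝒟 => ((φ : H), X φ) := by
    ext q
    rw [SetLike.mem_coe, LinearPMap.mem_graph_iff']
    rfl
  rw [← this]
  rfl

theorem exists_near_of_mem_graph_closedOp {𝒟 : Submodule ℂ H} {X : 𝒟 →ₗ[ℂ] H}
    (h𝒟 : Dense (𝒟 : Set H)) (hX : IsSymmetricOn X) {x y : H} (hxy : (x, y) ∈ (closedOp X).graph)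
    {ε : ℝ} (hε : 0 < ε) : ∃ φ : 𝒟, ‖(φ : H) - x‖ < ε ∧ ‖X φ - y‖ < ε := by
  rw [mem_graph_closedOp_iff h𝒟 hX] at hxy
  obtain ⟨_, ⟨φ, rfl⟩, h⟩ := Metric.mem_closure_iff.1 hxy ε hε
  rw [dist_comm, Prod.dist_eq, max_lt_iff, dist_eq_norm, dist_eq_norm] at h
  exact ⟨φ, h⟩

theorem inner_graph_closedOp {𝒟 : Submodule ℂ H} {X : 𝒟 →ₗ[ℂ] H} (h𝒟 : Dense (𝒟 : Set H))
    (hX : IsSymmetricOn X) {x y u v : H} (hx : (x, y) ∈ (closedOp X).graph)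
    (hu : (u, v) ∈ (closedOp X).graph) : inner ℂ y u = inner ℂ x v := by
  rw [mem_graph_closedOp_iff h𝒟 hX] at hx hu
  have hc : IsClosed {q : (H × H) × (H × H) | inner ℂ q.1.2 q.2.1 = inner ℂ q.1.1 q.2.2} :=
    isClosed_eq (by fun_prop) (by fun_prop)
  have h1 : ((x, y), (u, v)) ∈ closure ((Set.range fun φ : 𝒟 => ((φ : H), X φ)) ×ˢ
      (Set.range fun φ : 𝒟 => ((φ : H), X φ))) := by
    rw [closure_prod_eq]; exact ⟨hx, hu⟩
  refine hc.closure_subset_iff.2 ?_ h1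
  rintro ⟨_, _⟩ ⟨⟨φ, rfl⟩, ⟨χ, rfl⟩⟩
  exact hX φ χ

theorem apply_of_mem_graph_closedOp_nonneg {𝒟 : Submodule ℂ H} {X : 𝒟 →ₗ[ℂ] H}
    (h𝒟 : Dense (𝒟 : Set H)) (hX : IsSymmetricOn X) (h0 : ∀ ψ : 𝒟, 0 ≤ (inner ℂ (ψ : H) (X ψ)).re)
    {x y : H} (hx : (x, y) ∈ (closedOp X).graph) : 0 ≤ (inner ℂ x y).re := by
  rw [mem_graph_closedOp_iff h𝒟 hX] at hx
  have hc : IsClosed {q : H × H | 0 ≤ (inner ℂ q.1 q.2).re} :=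
    isClosed_le continuous_const (Complex.continuous_re.comp (by fun_prop))
  refine hc.closure_subset_iff.2 ?_ hx
  rintro _ ⟨φ, rfl⟩
  exact h0 φ

/-- The first GJN bound makes `X G` bounded on the dense subspace `{h | G h ∈ 𝒟}`, so it extends.
With `ψ = G h`, the commutator form with `Y` is `2 Im ⟪h, Z h⟫`, and the second bound extends by
continuity. -/
theorem IsGJNTriple.exists_relativization {Y : H →ₗ.[ℂ] H} {𝒟 : Submodule ℂ H} {G : H →L[ℂ] H}
    (hG : IsReferenceInverse Y 𝒟 G) {X : 𝒟 →ₗ[ℂ] H} (hX : IsGJNTriple X Y) :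
    ∃ Z : H →L[ℂ] H, IsRelativization G X Z := by
  obtain ⟨-, hs, k, hk⟩ := hX
  have hYG : ∀ h (hh : G h ∈ Y.domain), Y ⟨G h, hh⟩ = h := fun h hh =>
    ((LinearPMap.image_iff hh).2 (hG.mem_graph h)).symm
  have hdom : ∀ h, G h ∈ Y.domain := fun h => LinearPMap.mem_domain_of_mem_graph (hG.mem_graph h)
  let M : Submodule ℂ H := 𝒟.comap G.toLinearMap
  have hM : Dense (M : Set H) := hG.dense
  let f : M →L[ℂ] H := LinearMap.mkContinuous
    (X ∘ₗ (G.toLinearMap.restrict (p := M) (q := 𝒟) fun _ h => h)) |k| (by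
      rintro ⟨h, hh⟩
      have h1 := (hk ⟨G h, hh⟩ (hdom h)).1
      simp only [hYG] at h1
      refine h1.trans ?_
      change k * ‖h‖ ≤ |k| * ‖h‖
      gcongr
      exact le_abs_self k)
  let Z : H →L[ℂ] H := f.extend M.subtypeL
  have hZ : ∀ h (hh : G h ∈ 𝒟), Z h = X ⟨G h, hh⟩ := fun h hh =>
    ContinuousLinearMap.extend_eq f (e := M.subtypeL) hM.denseRange_val
      isUniformEmbedding_subtype_val.isUniformInducing (⟨h, hh⟩ : M)
  have hgr : ∀ h, (G h, Z h) ∈ (closedOp X).graph := by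
    intro h
    have hc : IsClosed {h | (G h, Z h) ∈ (closedOp X).graph} := by
      have h1 : IsClosed ((closedOp X).graph : Set (H × H)) :=
        (isClosable_of_isSymmetricOn hG.dense_domain hs).closure_isClosed
      exact h1.preimage (G.continuous.prodMk Z.continuous)
    refine hc.closure_subset_iff.2 (fun g hg => ?_) (hM h)
    rw [Set.mem_ofPred_eq, hZ g hg, mem_graph_closedOp_iff hG.dense_domain hs]
    exact subset_closure ⟨⟨G g, hg⟩, rfl⟩
  refine ⟨Z, hZ, hgr, fun g h => inner_graph_closedOp hG.dense_domain hs (hgr g) (hgr h), |k|,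
    abs_nonneg k, fun h => ?_⟩
  have hc : IsClosed {h | |(inner ℂ h (Z h)).im| ≤ |k| * (inner ℂ (G h) h).re} :=
    isClosed_le (continuous_abs.comp (Complex.continuous_im.comp (by fun_prop)))
      (continuous_const.mul (Complex.continuous_re.comp (by fun_prop)))
  refine hc.closure_subset_iff.2 (fun g hg => ?_) (hM h)
  have h1 := (hk ⟨G g, hg⟩ (hdom g)).2
  simp only [hYG, ← hZ g hg] at h1
  have h2 : (Complex.I * (inner ℂ (Z g) g - inner ℂ g (Z g))).re = 2 * (inner ℂ g (Z g)).im := by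
    have h3 : (inner ℂ (Z g) g).im = -(inner ℂ g (Z g)).im := by
      rw [← inner_conj_symm, Complex.conj_im]
    simp only [Complex.mul_re, Complex.I_re, Complex.I_im, Complex.sub_im, h3]
    ring
  rw [h2] at h1
  have h3 := hG.inner_re_nonneg g
  have h4 : k * (inner ℂ (G g) g).re ≤ |k| * (inner ℂ (G g) g).re := by
    gcongr; exact le_abs_self k
  have h5 : 0 ≤ |k| * (inner ℂ (G g) g).re := by positivity
  rw [Set.mem_ofPred_eq, abs_le]
  constructor <;> linarith

/-! ### Elliptic regularization -/

theorem inner_self_re (x : H) : (inner ℂ x x).re = ‖x‖ ^ 2 := by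
  simp [inner_self_eq_norm_sq_to_K, ← Complex.ofReal_pow]

theorem inner_self_eq_ofReal (x : H) : inner ℂ x x = ((‖x‖ ^ 2 : ℝ) : ℂ) := by
  simp [inner_self_eq_norm_sq_to_K]

section
variable {Y : H →ₗ.[ℂ] H} {𝒟 : Submodule ℂ H} {G Z : H →L[ℂ] H} {X : 𝒟 →ₗ[ℂ] H} {k ν ε : ℝ}

/-- The real part of `i ν ⟪h, Z h⟫` is `-ν Im ⟪h, Z h⟫`, which `⟪G h, h⟫` absorbs when `|ν| k ≤ 1`.
The remaining coercivity yields solvability. -/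
theorem re_inner_regularized (hk : ∀ h, |(inner ℂ h (Z h)).im| ≤ k * (inner ℂ (G h) h).re)
    (hG : IsReferenceInverse Y 𝒟 G) (hν : |ν| * k ≤ 1) (h : H) :
    ε * ‖h‖ ^ 2 ≤ (inner ℂ h ((ε : ℂ) • h + G h + (Complex.I * ν) • Z h)).re := by
  rw [inner_add_right, inner_add_right, inner_smul_right, inner_smul_right, inner_self_eq_ofReal,
    ← hG.symm]
  have h1 : (Complex.I * ν * inner ℂ h (Z h)).re = -(ν * (inner ℂ h (Z h)).im) := by
    simp [Complex.mul_re]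
  rw [Complex.add_re, Complex.add_re, h1, ← Complex.ofReal_mul, Complex.ofReal_re]
  have h2 : ν * (inner ℂ h (Z h)).im ≤ (inner ℂ (G h) h).re := by
    calc ν * (inner ℂ h (Z h)).im ≤ |ν| * |(inner ℂ h (Z h)).im| := by
          rw [← abs_mul]; exact le_abs_self _
      _ ≤ |ν| * (k * (inner ℂ (G h) h).re) := by gcongr; exact hk h
      _ = (|ν| * k) * (inner ℂ (G h) h).re := by ring
      _ ≤ 1 * (inner ℂ (G h) h).re := by gcongr; exact hG.inner_re_nonneg h
      _ = _ := one_mul _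
  linarith

/-- Solution of `(ε Y + 1 + i ν X) b = w` with `b = G h` in the domain of `Y`. -/
theorem exists_regularized (hk : ∀ h, |(inner ℂ h (Z h)).im| ≤ k * (inner ℂ (G h) h).re)
    (hG : IsReferenceInverse Y 𝒟 G) (hν : |ν| * k ≤ 1) (hε : 0 < ε) (w : H) :
    ∃ h, (ε : ℂ) • h + G h + (Complex.I * ν) • Z h = w := by
  let T : H →L[ℂ] H := (ε : ℂ) • ContinuousLinearMap.id ℂ H + G + (Complex.I * ν) • Z
  have hT : IsUnit T := by
    refine ContinuousLinearMap.isUnit_of_forall_le_norm_inner_map T (c := ⟨ε, hε.le⟩) hε fun h => ?_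
    calc ‖h‖ ^ 2 * ε = ε * ‖h‖ ^ 2 := mul_comm _ _
      _ ≤ (inner ℂ h (T h)).re := re_inner_regularized hk hG hν h
      _ ≤ ‖inner ℂ h (T h)‖ := Complex.re_le_norm _
      _ = ‖inner ℂ (T h) h‖ := norm_inner_symm _ _
  obtain ⟨h, hh⟩ := (ContinuousLinearMap.isUnit_iff_bijective.1 hT).2 w
  exact ⟨h, hh⟩

variable {h w : H}

theorem regularized_norm_le (hk : ∀ h, |(inner ℂ h (Z h)).im| ≤ k * (inner ℂ (G h) h).re)
    (hG : IsReferenceInverse Y 𝒟 G) (hν : |ν| * k ≤ 1)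
    (hw : (ε : ℂ) • h + G h + (Complex.I * ν) • Z h = w) : ε * ‖h‖ ≤ ‖w‖ := by
  have h1 := re_inner_regularized (ε := ε) hk hG hν h
  rw [hw] at h1
  have h2 : (inner ℂ h w).re ≤ ‖h‖ * ‖w‖ := (Complex.re_le_norm _).trans (norm_inner_le_norm _ _)
  rcases eq_or_lt_of_le (norm_nonneg h) with h0 | h0
  · rw [← h0, mul_zero]; exact norm_nonneg _
  · exact le_of_mul_le_mul_left (by nlinarith) h0

/-- Because `⟪b, X b⟫` is real for `b = G h`, pairing with `b` separates the energy and norm (real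
part) from `ν ⟪b, X b⟫` (imaginary part). -/
theorem regularized_inner (hG : IsReferenceInverse Y 𝒟 G) (hZ : IsRelativization G X Z)
    (hw : (ε : ℂ) • h + G h + (Complex.I * ν) • Z h = w) :
    (inner ℂ (G h) w).re = ε * (inner ℂ (G h) h).re + ‖G h‖ ^ 2 ∧
      (inner ℂ (G h) w).im = ν * (inner ℂ (G h) (Z h)).re := by
  have h1 : (inner ℂ (G h) (Z h)).im = 0 := by
    rw [← Complex.conj_eq_iff_im, inner_conj_symm, hZ.symm]
  rw [← hw, inner_add_right, inner_add_right, inner_smul_right, inner_smul_right,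
    inner_self_eq_ofReal]
  simp only [Complex.add_re, Complex.add_im, Complex.mul_re, Complex.mul_im, Complex.ofReal_re,
    Complex.ofReal_im, Complex.I_re, Complex.I_im, h1, hG.inner_im h]
  constructor <;> ring

theorem regularized_bounds (hG : IsReferenceInverse Y 𝒟 G) (hZ : IsRelativization G X Z)
    (hε : 0 < ε) (hw : (ε : ℂ) • h + G h + (Complex.I * ν) • Z h = w) :
    ‖G h‖ ≤ ‖w‖ ∧ ε * (inner ℂ (G h) h).re ≤ ‖w‖ ^ 2 := by
  have h1 := (regularized_inner hG hZ hw).1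
  have h2 : (inner ℂ (G h) w).re ≤ ‖G h‖ * ‖w‖ :=
    (Complex.re_le_norm _).trans (norm_inner_le_norm _ _)
  have h3 : 0 ≤ ε * (inner ℂ (G h) h).re := mul_nonneg hε.le (hG.inner_re_nonneg h)
  have h4 : ‖G h‖ ≤ ‖w‖ := by
    rcases eq_or_lt_of_le (norm_nonneg (G h)) with h0 | h0
    · rw [← h0]; exact norm_nonneg _
    · exact le_of_mul_le_mul_left (by nlinarith) h0
  exact ⟨h4, by nlinarith [norm_nonneg (G h), norm_nonneg w]⟩

/-- The regularizing term tends weakly to zero. -/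
theorem exists_regularized_inner_small
    (hk : ∀ h, |(inner ℂ h (Z h)).im| ≤ k * (inner ℂ (G h) h).re)
    (hG : IsReferenceInverse Y 𝒟 G) (hZ : IsRelativization G X Z) (hν : |ν| * k ≤ 1) (w y : H)
    {δ : ℝ} (hδ : 0 < δ) : ∃ ε : ℝ, 0 < ε ∧ ∃ h, (ε : ℂ) • h + G h + (Complex.I * ν) • Z h = w ∧
      ‖(ε : ℂ) * inner ℂ h y‖ < δ := by
  -- The vectors `ε h` stay bounded by `‖w‖`, and against `G g` they give `ε ⟪G h, g⟫ = O(ε)`;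
  -- density of the range of `G` handles the rest.
  obtain ⟨_, hd, g, rfl⟩ := Metric.dense_iff.1 hG.denseRange y (δ / (2 * (‖w‖ + 1))) (by positivity)
  have hyg : ‖y - G g‖ * (2 * (‖w‖ + 1)) < δ := by
    rw [← lt_div_iff₀ (by positivity), ← dist_eq_norm, dist_comm]; exact hd
  set ε : ℝ := δ / (2 * (‖w‖ + 1) * (‖g‖ + 1)) with hεd
  have hε : 0 < ε := by positivity
  obtain ⟨h, hh⟩ := exists_regularized hk hG hν hε w
  refine ⟨ε, hε, h, hh, ?_⟩
  have h1 := regularized_norm_le hk hG hν hh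
  have h2 := (regularized_bounds hG hZ hε hh).1
  have h3 : inner ℂ h y = inner ℂ h (y - G g) + inner ℂ (G h) g := by
    rw [hG.symm, ← inner_add_right, sub_add_cancel]
  have h4 : ε * (2 * (‖w‖ + 1) * (‖g‖ + 1)) = δ := by rw [hεd]; field_simp
  calc ‖(ε : ℂ) * inner ℂ h y‖ = ε * ‖inner ℂ h y‖ := by
        rw [norm_mul, Complex.norm_real, Real.norm_of_nonneg hε.le]
    _ ≤ ε * (‖h‖ * ‖y - G g‖ + ‖G h‖ * ‖g‖) := by
        rw [h3]
        gcongr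
        exact (norm_add_le _ _).trans (add_le_add (norm_inner_le_norm _ _) (norm_inner_le_norm _ _))
    _ = (ε * ‖h‖) * ‖y - G g‖ + ε * (‖G h‖ * ‖g‖) := by ring
    _ ≤ ‖w‖ * ‖y - G g‖ + ε * (‖w‖ * ‖g‖) := by gcongr
    _ < δ := by
        have h5 : ε * (‖w‖ * ‖g‖) ≤ ε * ((‖w‖ + 1) * (‖g‖ + 1)) := by
          gcongr <;> linarith
        nlinarith [norm_nonneg (y - G g), norm_nonneg w]

/-- Solve the regularized equation with right side `y` and pair it with `y`: only `ε ⟪h, y⟫`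
survives, and it can be made smaller than `‖y‖²`. This is the essential self-adjointness mechanism
for GJN triples. -/
theorem eq_zero_of_forall_inner_eq_zero
    (hk : ∀ h, |(inner ℂ h (Z h)).im| ≤ k * (inner ℂ (G h) h).re)
    (hG : IsReferenceInverse Y 𝒟 G) (hZ : IsRelativization G X Z) (hν : |ν| * k ≤ 1) {y : H}
    (hy : ∀ h, inner ℂ (G h + (Complex.I * ν) • Z h) y = 0) : y = 0 := by
  by_contra h0
  have hpos : 0 < ‖y‖ ^ 2 := by positivity
  obtain ⟨ε, hε, h, hh, hs⟩ := exists_regularized_inner_small hk hG hZ hν y y hpos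
  have h1 : inner ℂ y y = (ε : ℂ) * inner ℂ h y := by
    have h2 : inner ℂ ((ε : ℂ) • h + G h + (Complex.I * ν) • Z h) y = inner ℂ y y := by rw [hh]
    rw [← h2, add_assoc, inner_add_left, hy, add_zero, inner_smul_left, Complex.conj_ofReal]
  rw [← h1, inner_self_eq_ofReal, Complex.norm_real, Real.norm_of_nonneg (by positivity)] at hs
  exact lt_irrefl _ hs

theorem dense_range_one_add (hk : ∀ h, |(inner ℂ h (Z h)).im| ≤ k * (inner ℂ (G h) h).re)
    (hG : IsReferenceInverse Y 𝒟 G) (hZ : IsRelativization G X Z) (hν : |ν| * k ≤ 1) :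
    Dense (Set.range fun h => G h + (Complex.I * ν) • Z h) := by
  have h1 : (LinearMap.range (G + (Complex.I * ν) • Z).toLinearMap).topologicalClosure = ⊤ := by
    rw [Submodule.topologicalClosure_eq_top_iff, Submodule.eq_bot_iff]
    intro y hy
    exact eq_zero_of_forall_inner_eq_zero hk hG hZ hν fun h =>
      (Submodule.mem_orthogonal _ y).1 hy _ ⟨h, rfl⟩
  exact (Submodule.dense_iff_topologicalClosure_eq_top).2 h1

/-- The energy of the regularizing term tends to zero. -/
theorem eventually_regularized_energy_small
    (hk : ∀ h, |(inner ℂ h (Z h)).im| ≤ k * (inner ℂ (G h) h).re)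
    (hG : IsReferenceInverse Y 𝒟 G) (hZ : IsRelativization G X Z) (hν : |ν| * k ≤ 1) (w : H)
    {δ : ℝ} (hδ : 0 < δ) : ∀ᶠ ε : ℝ in 𝓝[>] 0, ∀ h,
      (ε : ℂ) • h + G h + (Complex.I * ν) • Z h = w → ε * (inner ℂ (G h) h).re < δ := by
  obtain ⟨_, hd, g, rfl⟩ := Metric.dense_iff.1 (dense_range_one_add hk hG hZ hν) w
    (Real.sqrt (δ / 16)) (by positivity)
  set κ := ‖w - (G g + (Complex.I * ν) • Z g)‖ with hκd
  have hκ : κ ^ 2 < δ / 16 := by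
    have : κ < Real.sqrt (δ / 16) := by rw [hκd, ← dist_eq_norm, dist_comm]; exact hd
    exact (Real.lt_sqrt (norm_nonneg _)).1 this
  have ht : Tendsto (fun ε : ℝ => 2 * (κ + ε * ‖g‖) ^ 2 + 2 * (ε * (inner ℂ (G g) g).re)) (𝓝[>] 0)
      (𝓝 (2 * (κ + 0 * ‖g‖) ^ 2 + 2 * (0 * (inner ℂ (G g) g).re))) := by
    refine (Continuous.tendsto ?_ 0).mono_left nhdsWithin_le_nhds
    fun_prop
  have hlt : 2 * (κ + 0 * ‖g‖) ^ 2 + 2 * (0 * (inner ℂ (G g) g).re) < δ := by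
    rw [zero_mul, zero_mul, add_zero]; linarith
  filter_upwards [ht.eventually_lt_const hlt, self_mem_nhdsWithin] with ε h1 hε h hh
  have hε : 0 < ε := hε
  -- `g` nearly solves the equation with `ε = 0`, so `h - g` solves it with a small right side. The
  -- parallelogram law for the form of `G` then carries the energy bound back to `h`.
  have h2 : (ε : ℂ) • (h - g) + G (h - g) + (Complex.I * ν) • Z (h - g) =
      (w - (G g + (Complex.I * ν) • Z g)) - (ε : ℂ) • g := by
    rw [← hh, map_sub, map_sub]; module
  have h3 := (regularized_bounds hG hZ hε h2).2
  have h4 : ‖w - (G g + (Complex.I * ν) • Z g) - (ε : ℂ) • g‖ ≤ κ + ε * ‖g‖ := by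
    refine (norm_sub_le _ _).trans ?_
    rw [norm_smul, Complex.norm_real, Real.norm_of_nonneg hε.le]
  have h5 : (inner ℂ (G h) h).re + (inner ℂ (G (h - g - g)) (h - g - g)).re =
      2 * (inner ℂ (G (h - g)) (h - g)).re + 2 * (inner ℂ (G g) g).re := by
    obtain ⟨d, rfl⟩ : ∃ d, h = d + g := ⟨h - g, by rw [sub_add_cancel]⟩
    simp only [add_sub_cancel_right, map_add, map_sub, inner_add_left, inner_add_right,
      inner_sub_left, inner_sub_right, Complex.add_re, Complex.sub_re]
    ring
  have h6 := hG.inner_re_nonneg (h - g - g)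
  have h7 : ‖w - (G g + (Complex.I * ν) • Z g) - (ε : ℂ) • g‖ ^ 2 ≤ (κ + ε * ‖g‖) ^ 2 := by gcongr
  have h8 : 0 ≤ ε * (inner ℂ (G (h - g - g)) (h - g - g)).re := by positivity
  have h9 : ε * (inner ℂ (G h) h).re + ε * (inner ℂ (G (h - g - g)) (h - g - g)).re =
      2 * (ε * (inner ℂ (G (h - g)) (h - g)).re) + 2 * (ε * (inner ℂ (G g) g).re) := by
    rw [← mul_add, h5]; ring
  linarith

/-- A nonnegative GJN operator has closure with `1 + T` invertible. -/
theorem exists_isOneAddInverse_closedOp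
    (hG : IsReferenceInverse Y 𝒟 G) (hZ : IsRelativization G X Z) (hX : IsSymmetricOn X)
    (h0 : ∀ ψ : 𝒟, 0 ≤ (inner ℂ (ψ : H) (X ψ)).re) :
    ∃ R, IsOneAddInverse (closedOp X) R := by
  obtain ⟨k, hk0, hk⟩ := hZ.form_bound
  have hpos : ∀ x y, (x, y) ∈ (closedOp X).graph → 0 ≤ (inner ℂ x y).re := fun x y hxy =>
    apply_of_mem_graph_closedOp_nonneg hG.dense_domain hX h0 hxy
  obtain ⟨R, hR, -⟩ := exists_isResolvent_of_isClosed (T := closedOp X) (z := -1) (c := 1)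
    (isClosable_of_isSymmetricOn hG.dense_domain hX).closure_isClosed one_pos
    (fun x y hxy => by
      have h1 := hpos x y hxy
      rw [neg_one_smul, sub_neg_eq_add, one_mul]
      have h2 : ‖x‖ ^ 2 ≤ (inner ℂ x (y + x)).re := by
        rw [inner_add_right, Complex.add_re, inner_self_re]; linarith
      have h3 : (inner ℂ x (y + x)).re ≤ ‖x‖ * ‖y + x‖ :=
        (Complex.re_le_norm _).trans (norm_inner_le_norm _ _)
      rcases eq_or_lt_of_le (norm_nonneg x) with h0 | h0
      · rw [← h0]; exact norm_nonneg _
      · exact le_of_mul_le_mul_left (by nlinarith) h0)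
    (fun w hw => by
      have hw' : ∀ h, inner ℂ (Z h) w = -inner ℂ (G h) w := fun h => by
        have := hw _ _ (hZ.mem_graph h)
        rwa [neg_one_smul, sub_neg_eq_add, inner_add_left, add_eq_zero_iff_eq_neg] at this
      set ν : ℝ := 1 / (k + 1) with hν
      have hνpos : 0 < ν := by positivity
      have hνk : |ν| * k ≤ 1 := by
        rw [abs_of_pos hνpos, hν, div_mul_eq_mul_div, div_le_one (by positivity)]; linarith
      by_contra hne
      have hwpos : 0 < ‖w‖ := norm_pos_iff.2 hne
      -- Testing gives `‖w‖² = r + (1 + i ν) c` with `c = ⟪G h, w⟫`. Positivity of `X` gives `0 ≤ Im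
      -- c`, hence `‖w‖² ≤ (1 + 1/ν) ‖r‖`, and `‖r‖ < δ` makes the right side less than `‖w‖² / 2`.
      set δ : ℝ := ν * ‖w‖ ^ 2 / (2 * (ν + 1)) with hδd
      have hδ : 0 < δ := by positivity
      obtain ⟨ε, hε, h, hh, hs⟩ := exists_regularized_inner_small hk hG hZ hνk w w hδ
      have h1 := (regularized_inner hG hZ hh).2
      have h2 := hpos _ _ (hZ.mem_graph h)
      set c := inner ℂ (G h) w with hc
      set r := (ε : ℂ) * inner ℂ h w with hr
      have h3 : ((‖w‖ ^ 2 : ℝ) : ℂ) = r + (1 + Complex.I * ν) * c := by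
        have h4 : inner ℂ ((ε : ℂ) • h + G h + (Complex.I * ν) • Z h) w = inner ℂ w w := by rw [hh]
        rw [← inner_self_eq_ofReal, ← h4, inner_add_left, inner_add_left, inner_smul_left, inner_smul_left, hw', map_mul,
          Complex.conj_ofReal, Complex.conj_ofReal, Complex.conj_I]
        ring
      have hre := congrArg Complex.re h3
      have him := congrArg Complex.im h3
      simp only [Complex.add_re, Complex.add_im, Complex.mul_re, Complex.mul_im, Complex.ofReal_re,
        Complex.ofReal_im, Complex.I_re, Complex.I_im, Complex.one_re, Complex.one_im] at hre him
      have h4 : 0 ≤ c.im := by rw [h1]; positivity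
      have h5 := (abs_le.1 (Complex.abs_re_le_norm r))
      have h6 := (abs_le.1 (Complex.abs_im_le_norm r))
      have h7 : δ * (2 * (ν + 1)) = ν * ‖w‖ ^ 2 := by rw [hδd]; field_simp
      nlinarith [mul_nonneg (sq_nonneg ν) h4])
  refine ⟨R, fun φ => ?_, fun ψ => ?_⟩
  · have h1 := hR.mem_graph φ
    have hm := LinearPMap.mem_domain_of_mem_graph h1
    refine ⟨hm, ?_⟩
    rw [← (LinearPMap.image_iff hm).2 h1]
    module
  · have := hR.apply_sub _ _ ((closedOp X).mem_graph ψ)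
    rwa [neg_one_smul, sub_neg_eq_add, add_comm] at this

end

/-! ### Regularized eigenvectors -/

section
variable {Y : H →ₗ.[ℂ] H} {𝒟 : Submodule ℂ H} {G ZL ZN ZD : H →L[ℂ] H} {L N : 𝒟 →ₗ[ℂ] H}

/-- Polarization: the form bound controls the commutator on the diagonal, and the parallelogram law
sums the four resulting energies. -/
theorem norm_commutator_le {k : ℝ}
    (hk : ∀ h, |(inner ℂ h (ZL h)).im| ≤ k * (inner ℂ (G h) h).re) (g h : H) :
    ‖inner ℂ g (ZL h) - inner ℂ (ZL g) h‖ ≤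
      2 * k * ((inner ℂ (G g) g).re + (inner ℂ (G h) h).re) := by
  set Q : H → ℂ := fun x => inner ℂ x (ZL x) - inner ℂ (ZL x) x with hQ
  have h1 : ∀ x, ‖Q x‖ ≤ 2 * k * (inner ℂ (G x) x).re := by
    intro x
    have h2 : Q x = ((2 * (inner ℂ x (ZL x)).im : ℝ) : ℂ) * Complex.I := by
      rw [hQ]
      dsimp only
      rw [← inner_conj_symm (ZL x) x, Complex.sub_conj]
    rw [h2, norm_mul, Complex.norm_I, mul_one, Complex.norm_real, Real.norm_eq_abs, abs_mul, abs_two]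
    have := hk x
    nlinarith
  have h3 : inner ℂ g (ZL h) - inner ℂ (ZL g) h = (1 / 4 : ℂ) * (Q (g + h) - Q (g - h) -
      Complex.I * Q (g + Complex.I • h) + Complex.I * Q (g - Complex.I • h)) := by
    simp only [hQ, map_add, map_sub, map_smul, inner_add_left, inner_add_right, inner_sub_left,
      inner_sub_right, inner_smul_left, inner_smul_right, Complex.conj_I]
    linear_combination (1 / 2) * (inner ℂ g (ZL h) - inner ℂ (ZL g) h -
      inner ℂ h (ZL g) + inner ℂ (ZL h) g) * Complex.I_sq
  have h4 : ‖inner ℂ g (ZL h) - inner ℂ (ZL g) h‖ ≤ 1 / 4 * (‖Q (g + h)‖ + ‖Q (g - h)‖ +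
      ‖Q (g + Complex.I • h)‖ + ‖Q (g - Complex.I • h)‖) := by
    rw [h3, norm_mul]
    have h5 : ‖(1 / 4 : ℂ)‖ = 1 / 4 := by norm_num
    rw [h5]
    gcongr
    refine (norm_add_le _ _).trans ?_
    rw [norm_mul, Complex.norm_I, one_mul]
    gcongr
    refine (norm_sub_le _ _).trans ?_
    rw [norm_mul, Complex.norm_I, one_mul]
    gcongr
    exact norm_sub_le _ _
  have h6 : ∀ x y : H, (inner ℂ (G (x + y)) (x + y)).re + (inner ℂ (G (x - y)) (x - y)).re =
      2 * ((inner ℂ (G x) x).re + (inner ℂ (G y) y).re) := by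
    intro x y
    simp only [map_add, map_sub, inner_add_left, inner_add_right,
      inner_sub_left, inner_sub_right, Complex.add_re, Complex.sub_re]
    ring
  have h7 : inner ℂ (G (Complex.I • h)) (Complex.I • h) = inner ℂ (G h) h := by
    rw [map_smul, inner_smul_left, inner_smul_right, Complex.conj_I]
    linear_combination -(inner ℂ (G h) h) * Complex.I_sq
  have h8 := h6 g h
  have h9 := h6 g (Complex.I • h)
  rw [h7] at h9
  have := h1 (g + h)
  have := h1 (g - h)
  have := h1 (g + Complex.I • h)
  have := h1 (g - Complex.I • h)
  calc _ ≤ _ := h4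
    _ ≤ 1 / 4 * (2 * k * ((inner ℂ (G (g + h)) (g + h)).re + (inner ℂ (G (g - h)) (g - h)).re) +
        2 * k * ((inner ℂ (G (g + Complex.I • h)) (g + Complex.I • h)).re +
          (inner ℂ (G (g - Complex.I • h)) (g - Complex.I • h)).re)) := by linarith
    _ = _ := by rw [h8, h9]; ring

/-- Rescaling `g` by `√m` and `h` by its inverse leaves the commutator unchanged; the free weight
`m` allows one energy to be absorbed later. -/
theorem norm_commutator_le_of_pos {k : ℝ}
    (hk : ∀ h, |(inner ℂ h (ZL h)).im| ≤ k * (inner ℂ (G h) h).re) (g h : H) {m : ℝ} (hm : 0 < m) :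
    ‖inner ℂ g (ZL h) - inner ℂ (ZL g) h‖ ≤
      2 * k * (m * (inner ℂ (G g) g).re + (inner ℂ (G h) h).re / m) := by
  have h1 := norm_commutator_le hk (((Real.sqrt m : ℝ) : ℂ) • g) ((((Real.sqrt m)⁻¹ : ℝ) : ℂ) • h)
  have hs : 0 < Real.sqrt m := Real.sqrt_pos.2 hm
  have hsC : ((Real.sqrt m : ℝ) : ℂ) ≠ 0 := by exact_mod_cast hs.ne'
  have hss : Real.sqrt m * Real.sqrt m = m := Real.mul_self_sqrt hm.le
  simp only [map_smul, inner_smul_left, inner_smul_right, Complex.conj_ofReal,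
    Complex.re_ofReal_mul] at h1
  have e1 : ∀ c : ℂ, (((Real.sqrt m)⁻¹ : ℝ) : ℂ) * (((Real.sqrt m : ℝ) : ℂ) * c) = c := by
    intro c
    rw [← mul_assoc, Complex.ofReal_inv, inv_mul_cancel₀ hsC, one_mul]
  have e2 : Real.sqrt m * (Real.sqrt m * (inner ℂ (G g) g).re) = m * (inner ℂ (G g) g).re := by
    rw [← mul_assoc, hss]
  have e3 : (Real.sqrt m)⁻¹ * ((Real.sqrt m)⁻¹ * (inner ℂ (G h) h).re) =
      (inner ℂ (G h) h).re / m := by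
    rw [← mul_assoc, ← mul_inv, hss, div_eq_inv_mul]
  rwa [e1, e1, e2, e3] at h1

/-- The commutator estimate for `(L - e) b`, where `(ε Y + 1 + i ν N) b = w`. -/
theorem norm_apply_sub_sq_le {kL kN ν ε : ℝ} (hG : IsReferenceInverse Y 𝒟 G)
    (hL : IsRelativization G L ZL) (hN : IsRelativization G N ZN)
    (hcomm : ∀ g h, inner ℂ (G g) (ZD h) =
      Complex.I * (inner ℂ (ZL g) (ZN h) - inner ℂ (ZN g) (ZL h)))
    (hkL0 : 0 ≤ kL) (hkL : ∀ h, |(inner ℂ h (ZL h)).im| ≤ kL * (inner ℂ (G h) h).re)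
    (hkN : ∀ h, |(inner ℂ h (ZN h)).im| ≤ kN * (inner ℂ (G h) h).re)
    (hν : |ν| * kN ≤ 1) (hε : 0 < ε) (e : ℂ) {h w : H}
    (hw : (ε : ℂ) • h + G h + (Complex.I * ν) • ZN h = G w) :
    ‖ZL h - e • G h‖ ^ 2 ≤ 2 * (‖ZL w - e • G w‖ + |ν| * ‖ZD h‖) ^ 2 +
      32 * kL * (kL + 1) * (ε * (inner ℂ (G h) h).re) := by
  set z := ZL h - e • G h with hz
  -- Duality: `a` solves the adjoint equation with right side `z`. Expanding `⟪z, z⟫` and moving the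
  -- operators across produces `(L - e) G w`, `ν D` and `ε [Λ, L]` without applying `N` to `z`.
  obtain ⟨a, ha⟩ := exists_regularized (ν := -ν) hkN hG (by rwa [abs_neg]) hε z
  have hb := regularized_bounds hG hN hε ha
  have h1 : inner ℂ z z = inner ℂ (G a) (ZL w - e • G w) - ν * inner ℂ (G a) (ZD h) +
      ε * (inner ℂ a (ZL h) - inner ℂ (ZL a) h) := by
    have e1 : inner ℂ z z = ε * inner ℂ a z + inner ℂ (G a) z + Complex.I * ν * inner ℂ (ZN a) z := by
      have : inner ℂ ((ε : ℂ) • a + G a + (Complex.I * (-ν : ℝ)) • ZN a) z = inner ℂ z z := by rw [ha]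
      rw [← this]
      simp only [inner_add_left, inner_smul_left, map_mul, Complex.conj_ofReal, Complex.conj_I]
      push_cast
      ring
    have e2 : inner ℂ (G a) (G w) =
        ε * inner ℂ (G a) h + inner ℂ (G a) (G h) + Complex.I * ν * inner ℂ (G a) (ZN h) := by
      rw [← hw]
      simp only [inner_add_right, inner_smul_right]
    have e3 : inner ℂ (ZL a) (G w) =
        ε * inner ℂ (ZL a) h + inner ℂ (ZL a) (G h) + Complex.I * ν * inner ℂ (ZL a) (ZN h) := by
      rw [← hw]
      simp only [inner_add_right, inner_smul_right]
    rw [hL.symm] at e3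
    rw [e1, inner_sub_right (G a) (ZL w), e3, inner_smul_right (G a) (G w), e2, hcomm, hz]
    simp only [inner_sub_right, inner_smul_right]
    rw [hL.symm a h, hG.symm a h, hN.symm a h]
    linear_combination (0 : ℂ) * Complex.I_sq
  have h2 : ‖z‖ ^ 2 ≤ ‖z‖ * (‖ZL w - e • G w‖ + |ν| * ‖ZD h‖) +
      ε * ‖inner ℂ a (ZL h) - inner ℂ (ZL a) h‖ := by
    calc ‖z‖ ^ 2 = ‖inner ℂ z z‖ := by
          rw [inner_self_eq_ofReal, Complex.norm_real, Real.norm_of_nonneg (by positivity)]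
      _ ≤ ‖inner ℂ (G a) (ZL w - e • G w)‖ + ‖(ν : ℂ) * inner ℂ (G a) (ZD h)‖ +
          ‖(ε : ℂ) * (inner ℂ a (ZL h) - inner ℂ (ZL a) h)‖ := by
          rw [h1]
          exact (norm_add_le _ _).trans (by gcongr; exact norm_sub_le _ _)
      _ ≤ ‖G a‖ * ‖ZL w - e • G w‖ + |ν| * (‖G a‖ * ‖ZD h‖) +
          ε * ‖inner ℂ a (ZL h) - inner ℂ (ZL a) h‖ := by
          rw [norm_mul, norm_mul, Complex.norm_real, Complex.norm_real, Real.norm_of_nonneg hε.le,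
            Real.norm_eq_abs]
          gcongr <;> exact norm_inner_le_norm _ _
      _ ≤ ‖z‖ * ‖ZL w - e • G w‖ + |ν| * (‖z‖ * ‖ZD h‖) +
          ε * ‖inner ℂ a (ZL h) - inner ℂ (ZL a) h‖ := by
          gcongr <;> exact hb.1
      _ = _ := by ring
  -- Chosen so that `2 kL m ≤ 1/4`: the energy of `a`, at most `‖z‖²`, is then absorbed on the left.
  set m : ℝ := 1 / (8 * (kL + 1)) with hm
  have hmpos : 0 < m := by positivity
  have h3 := norm_commutator_le_of_pos hkL a h hmpos
  set ta := (inner ℂ (G a) a).re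
  set th := (inner ℂ (G h) h).re with hth
  have hth0 : 0 ≤ th := hG.inner_re_nonneg h
  have hta0 : 0 ≤ ta := hG.inner_re_nonneg a
  have h4 : ε * ‖inner ℂ a (ZL h) - inner ℂ (ZL a) h‖ ≤
      1 / 4 * ‖z‖ ^ 2 + 16 * kL * (kL + 1) * (ε * th) := by
    have e1 : 2 * kL * m ≤ 1 / 4 := by
      rw [hm, mul_one_div, div_le_iff₀ (by positivity)]; linarith
    have e2 : 2 * kL * (th / m) = 16 * kL * (kL + 1) * th := by
      rw [hm]; field_simp; ring
    calc ε * ‖inner ℂ a (ZL h) - inner ℂ (ZL a) h‖ ≤ ε * (2 * kL * (m * ta + th / m)) := by gcongr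
      _ = (2 * kL * m) * (ε * ta) + ε * (2 * kL * (th / m)) := by ring
      _ ≤ 1 / 4 * ‖z‖ ^ 2 + ε * (2 * kL * (th / m)) := by
          gcongr
          exact hb.2
      _ = _ := by rw [e2]; ring
  set y := ‖ZL w - e • G w‖ + |ν| * ‖ZD h‖
  nlinarith [sq_nonneg (‖z‖ - 2 * y)]

/-- Eigenvectors of `L` are limits of vectors in `𝒟` on which `L - e` is small and `N` is
controlled. -/
theorem exists_approximate_eigenvectors {k : ℝ} (hG : IsReferenceInverse Y 𝒟 G)
    (hL : IsRelativization G L ZL) (hN : IsRelativization G N ZN) (hLs : IsSymmetricOn L)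
    (hcomm : ∀ g h, inner ℂ (G g) (ZD h) =
      Complex.I * (inner ℂ (ZL g) (ZN h) - inner ℂ (ZN g) (ZL h)))
    (hk : 0 ≤ k) (hDb : ∀ h, ‖ZD h‖ ≤ k * (Real.sqrt (inner ℂ (G h) (ZN h)).re + ‖G h‖))
    {ψ : H} {e : ℂ} (hψ : (ψ, e • ψ) ∈ (closedOp L).graph) :
    ∃ C : ℝ, 0 < C ∧ ∀ κ > 0, ∀ᶠ ν : ℝ in 𝓝[>] 0, ∃ h, G h ∈ 𝒟 ∧ ‖G h - ψ‖ < κ ∧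
      ‖ZL h - e • G h‖ ^ 2 < C * ν ∧ ν * (inner ℂ (G h) (ZN h)).re < C := by
  obtain ⟨kL, hkL0, hkL⟩ := hL.form_bound
  obtain ⟨kN, hkN0, hkN⟩ := hN.form_bound
  set B := ‖ψ‖ + 1 with hB
  set K := 32 * kL * (kL + 1) with hK
  have hK0 : 0 ≤ K := by positivity
  set C := 2 * (1 + ‖e‖ + k * (2 * B)) ^ 2 + K + B ^ 2 + 1 with hC
  refine ⟨C, by positivity, fun κ hκ => ?_⟩
  obtain ⟨_, hgd, g, rfl⟩ := Metric.dense_iff.1 hG.denseRange ψ (κ / 8) (by positivity)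
  have hg : ‖ψ - G g‖ < κ / 8 := by rw [← dist_eq_norm, dist_comm]; exact hgd
  have hsmall : ∀ᶠ ν : ℝ in 𝓝[>] 0, ν < 1 ∧ ν * kN < 1 ∧
      Real.sqrt ν + ν * (‖g‖ + ‖ZN g‖) < κ / 8 := by
    have t1 : Tendsto (fun ν : ℝ => ν * kN) (𝓝[>] 0) (𝓝 (0 * kN)) :=
      (Continuous.tendsto (by fun_prop) 0).mono_left nhdsWithin_le_nhds
    have t2 : Tendsto (fun ν : ℝ => Real.sqrt ν + ν * (‖g‖ + ‖ZN g‖)) (𝓝[>] 0)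
        (𝓝 (Real.sqrt 0 + 0 * (‖g‖ + ‖ZN g‖))) :=
      (Continuous.tendsto (by fun_prop) 0).mono_left nhdsWithin_le_nhds
    have t3 : Tendsto (fun ν : ℝ => ν) (𝓝[>] 0) (𝓝 0) :=
      (Continuous.tendsto continuous_id 0).mono_left nhdsWithin_le_nhds
    rw [zero_mul] at t1
    rw [Real.sqrt_zero, zero_mul, add_zero] at t2
    filter_upwards [t1.eventually_lt_const one_pos, t3.eventually_lt_const one_pos,
      t2.eventually_lt_const (show 0 < κ / 8 by positivity)] with ν a b c
    exact ⟨b, a, c⟩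
  filter_upwards [hsmall, self_mem_nhdsWithin] with ν ⟨hν1, hνN, hνκ⟩ hν0
  have hν0 : 0 < ν := hν0
  have hs0 : 0 < Real.sqrt ν := Real.sqrt_pos.2 hν0
  have hss : Real.sqrt ν ^ 2 = ν := Real.sq_sqrt hν0.le
  have hs1 : Real.sqrt ν ≤ 1 := by rw [Real.sqrt_le_one]; exact hν1.le
  have hνk : |ν| * kN ≤ 1 := by rw [abs_of_pos hν0]; exact hνN.le
  obtain ⟨φ₀, hφ1, hφ2⟩ := exists_near_of_mem_graph_closedOp hG.dense_domain hLs hψ hs0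
  obtain ⟨w, hw⟩ : ∃ w, G w = φ₀ ∧ ZL w = L φ₀ := by
    obtain ⟨w, hw⟩ := hG.exists_eq φ₀ φ₀.2
    refine ⟨w, hw, ?_⟩
    rw [hL.apply_eq w (hw ▸ φ₀.2)]
    congr 1
    exact Subtype.ext hw
  rw [← hw.1] at hφ1
  rw [← hw.2] at hφ2
  have hwB : ‖G w‖ ≤ B := by
    have := norm_add_le (G w - ψ) ψ
    rw [sub_add_cancel] at this
    linarith
  have hLw : ‖ZL w - e • G w‖ ≤ (1 + ‖e‖) * Real.sqrt ν := by
    have e1 : ZL w - e • G w = (ZL w - e • ψ) - e • (G w - ψ) := by rw [smul_sub]; abel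
    rw [e1]
    refine (norm_sub_le _ _).trans ?_
    rw [norm_smul]
    nlinarith [norm_nonneg e]
  -- `ε` is chosen after `ν` and `w`, so that the energy is below `ν` with no quantitative control
  -- of `w`.
  obtain ⟨ε, ⟨hε, hε0, hεν⟩⟩ := ((eventually_regularized_energy_small hkN hG hN hνk (G w) hν0).and
    ((eventually_mem_nhdsWithin (s := Set.Ioi 0)).and
      ((tendsto_id.mono_left nhdsWithin_le_nhds).eventually_lt_const hν0))).exists
  have hε0 : 0 < ε := hε0
  have hεν : ε < ν := hεν
  obtain ⟨h, hh⟩ := exists_regularized hkN hG hνk hε0 (G w)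
  have hen := hε h hh
  have hb := regularized_bounds hG hN hε0 hh
  have hGh : ‖G h‖ ≤ B := hb.1.trans hwB
  have hNh : ν * (inner ℂ (G h) (ZN h)).re ≤ B ^ 2 := by
    rw [← (regularized_inner hG hN hh).2]
    calc (inner ℂ (G h) (G w)).im ≤ ‖inner ℂ (G h) (G w)‖ :=
          (le_abs_self _).trans (Complex.abs_im_le_norm _)
      _ ≤ ‖G h‖ * ‖G w‖ := norm_inner_le_norm _ _
      _ ≤ B * B := by gcongr
      _ = B ^ 2 := by ring
  have hDh : |ν| * ‖ZD h‖ ≤ k * (2 * B) * Real.sqrt ν := by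
    rw [abs_of_pos hν0]
    have hB0 : 0 ≤ B := by positivity
    have e1 : Real.sqrt ν * Real.sqrt (inner ℂ (G h) (ZN h)).re ≤ B := by
      rw [← Real.sqrt_mul hν0.le]
      exact Real.sqrt_le_iff.2 ⟨hB0, hNh⟩
    have e2 : Real.sqrt ν * ‖G h‖ ≤ B := by
      calc Real.sqrt ν * ‖G h‖ ≤ 1 * B := by gcongr
        _ = B := one_mul B
    calc ν * ‖ZD h‖ ≤ ν * (k * (Real.sqrt (inner ℂ (G h) (ZN h)).re + ‖G h‖)) := by
          gcongr; exact hDb h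
      _ = Real.sqrt ν ^ 2 * (k * (Real.sqrt (inner ℂ (G h) (ZN h)).re + ‖G h‖)) := by rw [hss]
      _ = k * (Real.sqrt ν * Real.sqrt (inner ℂ (G h) (ZN h)).re + Real.sqrt ν * ‖G h‖) *
          Real.sqrt ν := by ring
      _ ≤ k * (B + B) * Real.sqrt ν := by gcongr
      _ = _ := by ring
  have hmain : ‖ZL h - e • G h‖ ^ 2 < C * ν := by
    have e1 := norm_apply_sub_sq_le (ZD := ZD) hG hL hN hcomm hkL0 hkL hkN hνk hε0 e hh
    calc _ ≤ _ := e1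
      _ ≤ 2 * ((1 + ‖e‖) * Real.sqrt ν + k * (2 * B) * Real.sqrt ν) ^ 2 + K * ν := by
          gcongr
      _ = (2 * (1 + ‖e‖ + k * (2 * B)) ^ 2) * Real.sqrt ν ^ 2 + K * ν := by ring
      _ = (2 * (1 + ‖e‖ + k * (2 * B)) ^ 2 + K) * ν := by rw [hss]; ring
      _ < C * ν := by
          gcongr
          rw [hC]
          nlinarith [sq_nonneg B]
  -- `g` was fixed before `ν`. The equation for `h - g` has right side `G w - G g` plus terms of
  -- order `ν`, and the solution map is contractive.
  have hnear : ‖G h - ψ‖ < κ := by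
    have e1 : (ε : ℂ) • (h - g) + G (h - g) + (Complex.I * ν) • ZN (h - g) =
        (G w - G g) - (ε : ℂ) • g - (Complex.I * ν) • ZN g := by
      rw [← hh, map_sub, map_sub]; module
    have e2 := (regularized_bounds hG hN hε0 e1).1
    rw [map_sub] at e2
    have e3 : ‖G w - G g - (ε : ℂ) • g - (Complex.I * ν) • ZN g‖ ≤
        ‖G w - G g‖ + ε * ‖g‖ + ν * ‖ZN g‖ := by
      refine (norm_sub_le _ _).trans ?_
      rw [norm_smul (Complex.I * ν), norm_mul, Complex.norm_I, one_mul, Complex.norm_real,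
        Real.norm_of_nonneg hν0.le]
      gcongr
      refine (norm_sub_le _ _).trans ?_
      rw [norm_smul, Complex.norm_real, Real.norm_of_nonneg hε0.le]
    have e4 : ‖G w - G g‖ ≤ ‖G w - ψ‖ + ‖ψ - G g‖ := by
      have := norm_add_le (G w - ψ) (ψ - G g)
      rwa [sub_add_sub_cancel] at this
    have e5 : ‖G h - ψ‖ ≤ ‖G h - G g‖ + ‖ψ - G g‖ := by
      have := norm_sub_le (G h - G g) (ψ - G g)
      rwa [sub_sub_sub_cancel_right] at this
    have e6 : ε * ‖g‖ ≤ ν * ‖g‖ := by gcongr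
    linarith
  -- So far `G h` is only in `D(Λ)`. The strict inequalities are open in `h`, so density of `{x | G
  -- x ∈ 𝒟}` moves the vector into `𝒟`.
  have hopen : IsOpen {x : H | ‖G x - ψ‖ < κ ∧ ‖ZL x - e • G x‖ ^ 2 < C * ν ∧
      ν * (inner ℂ (G x) (ZN x)).re < C} := by
    have c1 : Continuous fun x : H => ‖G x - ψ‖ := by fun_prop
    have c2 : Continuous fun x : H => ‖ZL x - e • G x‖ ^ 2 := by fun_prop
    have c3 : Continuous fun x : H => ν * (inner ℂ (G x) (ZN x)).re :=
      continuous_const.mul (Complex.continuous_re.comp (by fun_prop))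
    exact (isOpen_lt c1 continuous_const).inter
      ((isOpen_lt c2 continuous_const).inter (isOpen_lt c3 continuous_const))
  have hCB : B ^ 2 < C := by
    rw [hC]
    have : 0 ≤ 2 * (1 + ‖e‖ + k * (2 * B)) ^ 2 := by positivity
    linarith
  obtain ⟨x, hx, hxm⟩ := hG.dense.inter_open_nonempty _ hopen ⟨h, hnear, hmain, hNh.trans_lt hCB⟩
  exact ⟨x, hxm, hx⟩

end

/-! ### Propagation of the domain of the reference operator -/

theorem tendsto_inner_of_dense {ι : Type*} {l : Filter ι} {p : ι → H} {p' : H} {C : ℝ}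
    (hp : ∀ᶠ i in l, ‖p i‖ ≤ C) {S : Set H} (hS : Dense S)
    (h : ∀ x ∈ S, Tendsto (fun i => inner ℂ x (p i)) l (𝓝 (inner ℂ x p'))) (x : H) :
    Tendsto (fun i => inner ℂ x (p i)) l (𝓝 (inner ℂ x p')) := by
  rw [Metric.tendsto_nhds]
  intro ε hε
  obtain ⟨y, hy, hyS⟩ := Metric.dense_iff.1 hS x (ε / (2 * (|C| + ‖p'‖ + 1))) (by positivity)
  have hxy : ‖x - y‖ < ε / (2 * (|C| + ‖p'‖ + 1)) := by
    rw [← dist_eq_norm, dist_comm]; exact hy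
  rw [lt_div_iff₀ (by positivity)] at hxy
  filter_upwards [hp, Metric.tendsto_nhds.1 (h y hyS) (ε / 2) (by positivity)] with i h1 h2
  rw [dist_eq_norm] at h2 ⊢
  have h3 : inner ℂ x (p i) - inner ℂ x p' = inner ℂ (x - y) (p i) +
      (inner ℂ y (p i) - inner ℂ y p') - inner ℂ (x - y) p' := by
    rw [inner_sub_left, inner_sub_left]; ring
  have h4 : ‖inner ℂ (x - y) (p i)‖ ≤ ‖x - y‖ * |C| :=
    (norm_inner_le_norm _ _).trans (by gcongr; exact h1.trans (le_abs_self C))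
  have h5 : ‖inner ℂ (x - y) p'‖ ≤ ‖x - y‖ * ‖p'‖ := norm_inner_le_norm _ _
  calc _ ≤ ‖inner ℂ (x - y) (p i)‖ + ‖inner ℂ y (p i) - inner ℂ y p'‖ + ‖inner ℂ (x - y) p'‖ := by
        rw [h3]; exact (norm_sub_le _ _).trans (by gcongr; exact norm_add_le _ _)
    _ < ε := by nlinarith [norm_nonneg (x - y)]

theorem tendsto_inner_of_tendsto_of_weak {ι : Type*} {l : Filter ι} {p q : ι → H} {p' q' : H}
    {C : ℝ} (hp : ∀ᶠ i in l, ‖p i‖ ≤ C) (hq : Tendsto q l (𝓝 q'))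
    (h : Tendsto (fun i => inner ℂ q' (p i)) l (𝓝 (inner ℂ q' p'))) :
    Tendsto (fun i => inner ℂ (q i) (p i)) l (𝓝 (inner ℂ q' p')) := by
  have h1 : Tendsto (fun i => inner ℂ (q i - q') (p i)) l (𝓝 0) := by
    have h2 : Tendsto (fun i => ‖q i - q'‖ * C) l (𝓝 0) := by
      simpa using (tendsto_iff_norm_sub_tendsto_zero.1 hq).mul_const C
    refine squeeze_zero_norm' ?_ h2
    filter_upwards [hp] with i hi
    exact (norm_inner_le_norm _ _).trans (by gcongr)
  have h3 := h1.add h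
  rw [zero_add] at h3
  refine h3.congr fun i => ?_
  rw [← inner_add_left, sub_add_cancel]

/-- The group `W t = Y (U t) Y⁻¹`, where `G = Y⁻¹`. -/
structure IsTransported (G : H →L[ℂ] H) (U W : ℝ → H →L[ℂ] H) : Prop where
  apply_eq : ∀ t h, U t (G h) = G (W t h)

section
variable {Y A : H →ₗ.[ℂ] H} {𝒟 : Submodule ℂ H} {G Z Z' : H →L[ℂ] H} {U W : ℝ → H →L[ℂ] H}
  {X : 𝒟 →ₗ[ℂ] H}

/-- Invariance of `D(Y)` defines `W t` pointwise; boundedness is the closed graph theorem. -/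
theorem exists_isTransported (hG : IsReferenceInverse Y 𝒟 G)
    (hinv : ∀ t x, x ∈ Y.domain → U t x ∈ Y.domain) :
    ∃ W : ℝ → H →L[ℂ] H, IsTransported G U W := by
  have h1 : ∀ t h, ∃ w, U t (G h) = G w := by
    intro t h
    have h2 := hinv t (G h) (LinearPMap.mem_domain_of_mem_graph (hG.mem_graph h))
    exact ⟨Y ⟨_, h2⟩, (hG.apply_eq _ _ (Y.mem_graph ⟨_, h2⟩)).symm⟩
  choose w hw using h1
  let f : ℝ → H →ₗ[ℂ] H := fun t =>
    { toFun := w t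
      map_add' := fun x y => hG.injective (by rw [map_add, ← hw, ← hw, ← hw, map_add, map_add])
      map_smul' := fun c x => hG.injective (by
        rw [RingHom.id_apply, map_smul, ← hw, ← hw, map_smul, map_smul]) }
  have hf : ∀ t, Continuous (f t) := fun t => by
    refine LinearMap.continuous_of_seq_closed_graph (f t) fun u x y hu hy => hG.injective ?_
    change G y = G (w t x)
    rw [← hw]
    refine tendsto_nhds_unique ((G.continuous.tendsto y).comp hy) ?_
    refine (((U t).continuous.comp G.continuous).tendsto x |>.comp hu).congr fun n => ?_
    exact hw t (u n)
  exact ⟨fun t => ⟨f t, hf t⟩, ⟨hw⟩⟩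

theorem IsTransported.add_apply (hW : IsTransported G U W) (hG : IsReferenceInverse Y 𝒟 G)
    (hU : IsUnitaryGroupOf A U) (s t : ℝ) (h : H) : W (s + t) h = W s (W t h) := by
  apply hG.injective
  rw [← hW.apply_eq, ← hW.apply_eq, ← hW.apply_eq, hU.add_apply]

theorem IsTransported.zero_apply (hW : IsTransported G U W) (hG : IsReferenceInverse Y 𝒟 G)
    (hU : IsUnitaryGroupOf A U) (h : H) : W 0 h = h := by
  apply hG.injective
  rw [← hW.apply_eq, hU.map_zero]
  rfl

/-- Baire's theorem: the sets `{s | ‖W s‖ ≤ n}` are closed, since their condition can be tested on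
matrix elements of `U s G`. One of them has interior, and the group law moves the bound to `t`. -/
theorem IsTransported.eventually_norm_le (hW : IsTransported G U W)
    (hG : IsReferenceInverse Y 𝒟 G) (hU : IsUnitaryGroupOf A U) (t : ℝ) :
    ∃ C : ℝ, ∀ᶠ s in 𝓝 t, ∀ h, ‖W s h‖ ≤ C * ‖h‖ := by
  let E : ℕ → Set ℝ := fun n => {s | ∀ h, ‖W s h‖ ≤ n * ‖h‖}
  have hE : ∀ n, E n = ⋂ h, ⋂ g, {s | ‖inner ℂ g (U s (G h))‖ ≤ n * ‖h‖ * ‖G g‖} := by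
    intro n
    ext s
    simp only [E, Set.mem_iInter, Set.mem_ofPred_eq]
    refine forall_congr' fun h => ⟨fun h1 g => ?_, fun h1 => ?_⟩
    · rw [hW.apply_eq, ← hG.symm, mul_comm]
      exact (norm_inner_le_norm _ _).trans (by gcongr)
    · have hcl : IsClosed {x : H | ‖inner ℂ x (W s h)‖ ≤ n * ‖h‖ * ‖x‖} :=
        isClosed_le (by fun_prop) (by fun_prop)
      have h2 : ‖inner ℂ (W s h) (W s h)‖ ≤ n * ‖h‖ * ‖W s h‖ := by
        refine hcl.closure_subset_iff.2 ?_ (hG.denseRange (W s h))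
        rintro _ ⟨g, rfl⟩
        rw [Set.mem_ofPred_eq, hG.symm, ← hW.apply_eq]
        exact h1 g
      rw [inner_self_eq_ofReal, Complex.norm_real, Real.norm_of_nonneg (by positivity), sq] at h2
      rcases eq_or_lt_of_le (norm_nonneg (W s h)) with h0 | h0
      · rw [← h0]; positivity
      · exact le_of_mul_le_mul_right h2 h0
  have hclosed : ∀ n, IsClosed (E n) := by
    intro n
    rw [hE]
    refine isClosed_iInter fun h => isClosed_iInter fun g => isClosed_le ?_ continuous_const
    exact (continuous_const.inner (hU.continuous (G h))).norm
  have hunion : ⋃ n, E n = Set.univ := by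
    refine Set.eq_univ_of_forall fun s => Set.mem_iUnion.2 ?_
    obtain ⟨n, hn⟩ := exists_nat_ge ‖W s‖
    exact ⟨n, fun h => ((W s).le_opNorm h).trans (by gcongr)⟩
  obtain ⟨n, t₀, ht₀⟩ := nonempty_interior_of_iUnion_of_closed hclosed hunion
  have hn : ∀ᶠ s in 𝓝 t₀, ∀ h, ‖W s h‖ ≤ n * ‖h‖ := mem_interior_iff_mem_nhds.1 ht₀
  refine ⟨n * ‖W (t - t₀)‖, ?_⟩
  have htend : Tendsto (fun s => s - (t - t₀)) (𝓝 t) (𝓝 t₀) := by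
    have : Tendsto (fun s => s - (t - t₀)) (𝓝 t) (𝓝 (t - (t - t₀))) :=
      (continuous_sub_right _).tendsto t
    rwa [sub_sub_cancel] at this
  filter_upwards [htend.eventually hn] with s hs h
  have h1 : W s h = W (s - (t - t₀)) (W (t - t₀) h) := by
    rw [← hW.add_apply hG hU, sub_add_cancel]
  rw [h1, mul_assoc]
  exact (hs _).trans (by gcongr; exact (W (t - t₀)).le_opNorm h)

/-- Against `G g`, symmetry moves `X` onto the fixed vector and leaves the strongly continuous `U`;
local boundedness covers general `x`. -/
theorem IsTransported.tendsto_inner (hW : IsTransported G U W) (hG : IsReferenceInverse Y 𝒟 G)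
    (hU : IsUnitaryGroupOf A U) (hZ : IsRelativization G X Z) (x h : H) (t : ℝ) :
    Tendsto (fun s => inner ℂ x (Z (W s h))) (𝓝 t) (𝓝 (inner ℂ x (Z (W t h)))) := by
  obtain ⟨C, hC⟩ := hW.eventually_norm_le hG hU t
  refine tendsto_inner_of_dense (C := ‖Z‖ * (C * ‖h‖)) ?_ hG.denseRange ?_ x
  · filter_upwards [hC] with s hs
    exact (Z.le_opNorm _).trans (by gcongr; exact hs h)
  · rintro _ ⟨g, rfl⟩
    simp only [← hZ.symm, ← hW.apply_eq]
    exact (continuous_const.inner (hU.continuous (G h))).tendsto t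

/-- Derivative of the matrix elements of the Heisenberg evolution. -/
theorem IsTransported.hasDerivAt_inner (hW : IsTransported G U W) (hG : IsReferenceInverse Y 𝒟 G)
    (hU : IsUnitaryGroupOf A U) (hZ : IsRelativization G X Z)
    (hcomm : ∀ g h u v, (G g, u) ∈ A.graph → (G h, v) ∈ A.graph →
      inner ℂ (G g) (Z' h) = Complex.I * (inner ℂ (Z g) v - inner ℂ u (Z h)))
    {h v : H} (hv : (G h, v) ∈ A.graph) (a x : ℝ) :
    HasDerivAt (fun s => inner ℂ (U (s - a) (G h)) (Z (W (s + a) h)))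
      (inner ℂ (U (x - a) (G h)) (Z' (W (x + a) h))) x := by
  have hu : HasDerivAt (fun s => U (s - a) (G h)) (Complex.I • U (x - a) v) x := by
    simpa using (hU.hasDerivAt hv (x - a)).comp_sub_const x a
  have hw : HasDerivAt (fun s => U (s + a) (G h)) (Complex.I • U (x + a) v) x := by
    simpa using (hU.hasDerivAt hv (x + a)).comp_add_const x a
  -- With the left vector frozen, symmetry moves `X` onto it, so only strong differentiability of
  -- `U` on `D(A)` is needed.
  have h1 : HasDerivAt (fun s => inner ℂ (U (x - a) (G h)) (Z (W (s + a) h)))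
      (inner ℂ (Z (W (x - a) h)) (Complex.I • U (x + a) v)) x := by
    have h2 : (fun s => inner ℂ (U (x - a) (G h)) (Z (W (s + a) h))) =
        fun s => inner ℂ (Z (W (x - a) h)) (U (s + a) (G h)) := by
      funext s
      rw [hW.apply_eq, hW.apply_eq, hZ.symm]
    rw [h2]
    have h3 := (hasDerivAt_const x (Z (W (x - a) h))).inner ℂ hw
    rwa [inner_zero_left, add_zero] at h3
  have hshift : Tendsto (fun s => s + a) (𝓝 x) (𝓝 (x + a)) := (continuous_add_const a).tendsto x
  obtain ⟨C, hC⟩ := hW.eventually_norm_le hG hU (x + a)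
  -- The left difference quotient converges strongly and the right vector is bounded and weakly
  -- continuous, which suffices for the product.
  have h3 : HasDerivAt (fun s => inner ℂ (U (s - a) (G h) - U (x - a) (G h)) (Z (W (s + a) h)))
      (inner ℂ (Complex.I • U (x - a) v) (Z (W (x + a) h))) x := by
    rw [hasDerivAt_iff_tendsto_slope] at hu ⊢
    have h4 : slope (fun s => inner ℂ (U (s - a) (G h) - U (x - a) (G h)) (Z (W (s + a) h))) x =
        fun s => inner ℂ (slope (fun s => U (s - a) (G h)) x s) (Z (W (s + a) h)) := by
      funext s
      rw [slope_def_module, slope_def_module, sub_self, inner_zero_left, sub_zero,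
        ← Complex.coe_smul, ← Complex.coe_smul, inner_smul_left, Complex.conj_ofReal, smul_eq_mul]
    rw [h4]
    refine tendsto_inner_of_tendsto_of_weak (C := ‖Z‖ * (C * ‖h‖)) ?_ hu ?_
    · filter_upwards [(hshift.mono_left nhdsWithin_le_nhds).eventually hC] with s hs
      exact (Z.le_opNorm _).trans (by gcongr; exact hs h)
    · exact (hW.tendsto_inner hG hU hZ _ h (x + a)).comp (hshift.mono_left nhdsWithin_le_nhds)
  have h5 := h3.add h1
  have h6 : inner ℂ (U (x - a) (G h)) (Z' (W (x + a) h)) =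
      inner ℂ (Complex.I • U (x - a) v) (Z (W (x + a) h)) +
        inner ℂ (Z (W (x - a) h)) (Complex.I • U (x + a) v) := by
    have h7 := hU.mem_graph_apply hv (x - a)
    have h8 := hU.mem_graph_apply hv (x + a)
    rw [hW.apply_eq] at h7 h8
    rw [hW.apply_eq, hcomm _ _ _ _ h7 h8, inner_smul_left, inner_smul_right, Complex.conj_I]
    ring
  rw [h6]
  refine h5.congr_of_eventuallyEq (Eventually.of_forall fun s => ?_)
  simp only [Pi.add_apply, inner_sub_left, sub_add_cancel]
end

/-! ### A symmetric difference estimate -/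

/-- Both terms equal `f₁ 0` up to second order. Symmetrization leaves only `f₂ t - f₂ (-t)`,
controlled by `f₃`, so no bound on `f₂` is required. -/
theorem norm_symm_add_sub_le {f f₁ f₂ f₃ : ℝ → ℂ} (h₀ : ∀ x, HasDerivAt f (f₁ x) x)
    (h₁ : ∀ x, HasDerivAt f₁ (f₂ x) x) (h₂ : ∀ x, HasDerivAt f₂ (f₃ x) x) {r S : ℝ}
    (hS : ∀ x, |x| ≤ r → ‖f₃ x‖ ≤ S) {x a : ℝ} (hx : |x| ≤ r) (ha : |a| ≤ r) (ha0 : a ≠ 0) :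
    ‖(f₁ x + f₁ (-x)) / 2 - (f a - f (-a)) / (2 * a)‖ ≤ 2 * S * r ^ 2 := by
  have hr : 0 ≤ r := (abs_nonneg x).trans hx
  have hS0 : 0 ≤ S := (norm_nonneg _).trans (hS x hx)
  have hneg : ∀ {g g' : ℝ → ℂ}, (∀ x, HasDerivAt g (g' x) x) →
      ∀ x, HasDerivAt (fun t => g (-t)) (-g' (-x)) x := by
    intro g g' hg x
    have h := (hg (-x)).scomp x (hasDerivAt_neg x)
    rw [neg_one_smul] at h
    exact h
  have hmem : ∀ {t}, |t| ≤ r ↔ t ∈ Set.Icc (-r) r := fun {t} => by rw [abs_le, Set.mem_Icc]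
  have e2 : ∀ t, |t| ≤ r → ‖f₂ t - f₂ (-t)‖ ≤ 2 * S * r := by
    intro t ht
    have h := Convex.norm_image_sub_le_of_norm_hasDerivWithin_le (f := f₂) (f' := f₃)
      (fun s _ => (h₂ s).hasDerivWithinAt) (fun s hs => hS s (hmem.2 hs)) (convex_Icc (-r) r)
      (hmem.1 (by rwa [abs_neg] : |-t| ≤ r)) (hmem.1 ht)
    refine h.trans ?_
    have h3 : ‖t - -t‖ ≤ 2 * r := by
      rw [sub_neg_eq_add, ← two_mul, norm_mul, Real.norm_eq_abs, Real.norm_eq_abs, abs_two]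
      linarith
    nlinarith
  have e1 : ∀ t, |t| ≤ r → ‖f₁ t + f₁ (-t) - 2 * f₁ 0‖ ≤ 2 * S * r ^ 2 := by
    intro t ht
    have hd : ∀ s, HasDerivAt (fun s => f₁ s + f₁ (-s) - 2 * f₁ 0) (f₂ s - f₂ (-s)) s := fun s => by
      have := ((h₁ s).add (hneg h₁ s)).sub_const (2 * f₁ 0)
      rwa [← sub_eq_add_neg] at this
    have h := Convex.norm_image_sub_le_of_norm_hasDerivWithin_le
      (fun s _ => (hd s).hasDerivWithinAt) (fun s hs => e2 s (hmem.2 hs)) (convex_Icc (-r) r)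
      (hmem.1 (by rwa [abs_zero] : |(0 : ℝ)| ≤ r)) (hmem.1 ht)
    have h3 : f₁ 0 + f₁ (-0) - 2 * f₁ 0 = 0 := by rw [neg_zero]; ring
    rw [h3, sub_zero, sub_zero, Real.norm_eq_abs] at h
    refine h.trans ?_
    have : 2 * S * r * |t| ≤ 2 * S * r * r := by gcongr
    linarith
  have e0 : ‖f a - f (-a) - 2 * a * f₁ 0‖ ≤ 2 * S * r ^ 2 * |a| := by
    have hd : ∀ s : ℝ, HasDerivAt (fun s : ℝ => f s - f (-s) - 2 * s * f₁ 0)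
        (f₁ s + f₁ (-s) - 2 * f₁ 0) s := fun s => by
      have h3 : HasDerivAt (fun s : ℝ => 2 * (s : ℂ) * f₁ 0) (2 * 1 * f₁ 0) s :=
        ((Complex.ofRealCLM.hasDerivAt (x := s)).const_mul (2 : ℂ)).mul_const (f₁ 0)
      have := ((h₀ s).sub (hneg h₀ s)).sub h3
      rwa [sub_neg_eq_add, mul_one] at this
    have h := Convex.norm_image_sub_le_of_norm_hasDerivWithin_le
      (fun s _ => (hd s).hasDerivWithinAt) (fun s hs => e1 s (hmem.2 hs)) (convex_Icc (-r) r)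
      (hmem.1 (by rwa [abs_zero] : |(0 : ℝ)| ≤ r)) (hmem.1 ha)
    simpa using h
  have haC : (a : ℂ) ≠ 0 := by exact_mod_cast ha0
  have hsplit : (f₁ x + f₁ (-x)) / 2 - (f a - f (-a)) / (2 * a) =
      (f₁ x + f₁ (-x) - 2 * f₁ 0) / 2 - (f a - f (-a) - 2 * a * f₁ 0) / (2 * a) := by
    field_simp
    ring
  rw [hsplit]
  refine (norm_sub_le _ _).trans ?_
  rw [norm_div, norm_div, norm_mul, Complex.norm_real, Real.norm_eq_abs]
  have h2 : ‖(2 : ℂ)‖ = 2 := by norm_num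
  rw [h2]
  have hapos : 0 < |a| := abs_pos.2 ha0
  have := e1 x hx
  have h4 : ‖f a - f (-a) - 2 * a * f₁ 0‖ / (2 * |a|) ≤ S * r ^ 2 := by
    rw [div_le_iff₀ (by positivity)]
    linarith
  linarith

/-! ### Averages over the unitary group -/

/-- The `j`-th of `m + 1` equidistant points of `[-α/2, α/2]`. -/
def node (α : ℝ) (m j : ℕ) : ℝ := j * (α / m) - α / 2

theorem node_reflect {α : ℝ} {m j : ℕ} (hm : 0 < m) (hj : j ≤ m) :
    node α m (m - j) = -node α m j := by
  have : (m : ℝ) ≠ 0 := by positivity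
  rw [node, node, Nat.cast_sub hj]
  field_simp
  ring

theorem abs_node_le {α : ℝ} (hα : 0 ≤ α) {m j : ℕ} (hm : 0 < m) (hj : j ≤ m) :
    |node α m j| ≤ α / 2 := by
  have h1 : (j : ℝ) * (α / m) ≤ α := by
    calc (j : ℝ) * (α / m) ≤ m * (α / m) := by gcongr
      _ = α := by field_simp
  have h2 : 0 ≤ (j : ℝ) * (α / m) := by positivity
  rw [node, abs_le]
  constructor <;> linarith

/-- The average of `U t x` over the nodes. -/
def average (U : ℝ → H →L[ℂ] H) (α : ℝ) (m : ℕ) (x : H) : H :=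
  ((((m : ℝ) + 1)⁻¹ : ℝ) : ℂ) • ∑ j ∈ Finset.range (m + 1), U (node α m j) x

theorem norm_average_sub_le {U : ℝ → H →L[ℂ] H} {α : ℝ} (hα : 0 ≤ α) {m : ℕ} (hm : 0 < m)
    {x y : H} {δ : ℝ} (h : ∀ t, |t| ≤ α / 2 → ‖U t x - y‖ ≤ δ) : ‖average U α m x - y‖ ≤ δ := by
  have hmpos : (0 : ℝ) < (m : ℝ) + 1 := by positivity
  have hmC : ((m : ℂ) + 1) ≠ 0 := by exact_mod_cast hmpos.ne'
  have h1 : average U α m x - y = ((((m : ℝ) + 1)⁻¹ : ℝ) : ℂ) •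
      ∑ j ∈ Finset.range (m + 1), (U (node α m j) x - y) := by
    rw [Finset.sum_sub_distrib, smul_sub, average, Finset.sum_const, Finset.card_range,
      ← Nat.cast_smul_eq_nsmul ℂ, smul_smul]
    push_cast
    rw [inv_mul_cancel₀ hmC, one_smul]
  rw [h1, norm_smul, Complex.norm_real, Real.norm_of_nonneg (by positivity), inv_mul_le_iff₀ hmpos]
  refine (norm_sum_le _ _).trans ?_
  calc ∑ j ∈ Finset.range (m + 1), ‖U (node α m j) x - y‖ ≤ ∑ j ∈ Finset.range (m + 1), δ :=
        Finset.sum_le_sum fun j hj => h _ (abs_node_le hα hm (Finset.mem_range_succ_iff.1 hj))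
    _ = ((m : ℝ) + 1) * δ := by simp

theorem IsTransported.average {G : H →L[ℂ] H} {U W : ℝ → H →L[ℂ] H} (hW : IsTransported G U W)
    (α : ℝ) (m : ℕ) (h : H) : average U α m (G h) = G (Virial.average W α m h) := by
  simp only [Virial.average, map_smul, map_sum, hW.apply_eq]

theorem IsUnitaryGroupOf.mem_unitary {A : H →ₗ.[ℂ] H} {U : ℝ → H →L[ℂ] H}
    (hU : IsUnitaryGroupOf A U) (t : ℝ) :
    U t ∈ unitary (H →L[ℂ] H) ∧ star (U t) = U (-t) := by
  have h1 : star (U t) = U (-t) := by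
    rw [ContinuousLinearMap.star_eq_adjoint, eq_comm, ContinuousLinearMap.eq_adjoint_iff]
    intro x y
    rw [hU.inner_map_left, neg_neg]
  refine ⟨?_, h1⟩
  rw [Unitary.mem_iff, h1, ← hU.map_add, ← hU.map_add, neg_add_cancel, add_neg_cancel]
  exact ⟨hU.map_zero, hU.map_zero⟩

theorem IsUnitaryGroupOf.pow {A : H →ₗ.[ℂ] H} {U : ℝ → H →L[ℂ] H}
    (hU : IsUnitaryGroupOf A U) (t : ℝ) (n : ℕ) : U t ^ n = U (n * t) := by
  induction n with
  | zero => simp [hU.map_zero]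
  | succ n ih => rw [pow_succ, ih, ← hU.map_add]; push_cast; ring_nf

/-- The commutator of `L - e` with the discretized sign of `A`. -/
theorem norm_sum_inner_sub_le {A : H →ₗ.[ℂ] H} {U : ℝ → H →L[ℂ] H} (hU : IsUnitaryGroupOf A U)
    (τ : ℝ) (M : ℕ) (x l : H) {e : ℂ} (he : starRingEnd ℂ e = e) :
    ‖∑ j ∈ Finset.range M, ∑ k ∈ Finset.range M, ((((k : ℝ) - j)⁻¹ : ℝ) : ℂ) *
      (inner ℂ l (U (((k : ℝ) - j) * τ) x) - inner ℂ x (U (((k : ℝ) - j) * τ) l))‖ ≤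
      2 * (M * Real.pi) * ‖l - e • x‖ * ‖x‖ := by
  obtain ⟨hV, hs⟩ := hU.mem_unitary τ
  have hS := norm_sum_star_pow_mul_pow_le_of_mem_unitary hV M
  have hpow : ∀ j k : ℕ, star (U τ) ^ j * U τ ^ k = U (((k : ℝ) - j) * τ) := by
    intro j k
    rw [hs, hU.pow, hU.pow, ← hU.map_add]
    ring_nf
  simp only [hpow] at hS
  set S := ∑ j ∈ Finset.range M, ∑ k ∈ Finset.range M,
    ((((k : ℝ) - j)⁻¹ : ℝ) : ℂ) • U (((k : ℝ) - j) * τ) with hSd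
  have h1 : ∑ j ∈ Finset.range M, ∑ k ∈ Finset.range M, ((((k : ℝ) - j)⁻¹ : ℝ) : ℂ) *
      (inner ℂ l (U (((k : ℝ) - j) * τ) x) - inner ℂ x (U (((k : ℝ) - j) * τ) l)) =
      inner ℂ (l - e • x) (S x) - inner ℂ x (S (l - e • x)) := by
    -- A real scalar commutes with `S`, so `L` may be replaced by `L - e`, the small quantity.
    have h2 : inner ℂ (l - e • x) (S x) - inner ℂ x (S (l - e • x)) =
        inner ℂ l (S x) - inner ℂ x (S l) := by
      rw [map_sub, map_smul, inner_sub_left, inner_sub_right, inner_smul_left, inner_smul_right, he]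
      ring
    rw [h2, hSd]
    simp only [sum_apply, smul_apply, inner_sum,
      inner_smul_right, mul_sub, Finset.sum_sub_distrib]
  rw [h1]
  calc _ ≤ ‖l - e • x‖ * ‖S x‖ + ‖x‖ * ‖S (l - e • x)‖ :=
        (norm_sub_le _ _).trans (add_le_add (norm_inner_le_norm _ _) (norm_inner_le_norm _ _))
    _ ≤ ‖l - e • x‖ * (M * Real.pi * ‖x‖) + ‖x‖ * (M * Real.pi * ‖l - e • x‖) := by
        gcongr <;> exact S.le_of_opNorm_le hS _
    _ = _ := by ring

section
variable {Y A : H →ₗ.[ℂ] H} {𝒟 : Submodule ℂ H} {G : H →L[ℂ] H} {U W : ℝ → H →L[ℂ] H}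

/-- The form of `C₁` in the averaged vector. -/
theorem norm_inner_average_le {X : Fin 4 → 𝒟 →ₗ[ℂ] H} {Z : Fin 4 → H →L[ℂ] H}
    (hG : IsReferenceInverse Y 𝒟 G) (hU : IsUnitaryGroupOf A U) (hW : IsTransported G U W)
    (hZ : ∀ n, IsRelativization G (X n) (Z n))
    (hcomm : ∀ (n : Fin 3) g h u v, (G g, u) ∈ A.graph → (G h, v) ∈ A.graph →
      inner ℂ (G g) (Z n.succ h) =
        Complex.I * (inner ℂ (Z n.castSucc g) v - inner ℂ u (Z n.castSucc h)))
    {h v : H} (hv : (G h, v) ∈ A.graph) {e : ℂ} (he : starRingEnd ℂ e = e) {α : ℝ} (hα : 0 < α)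
    {m : ℕ} (hm : 0 < m) {B S : ℝ} (hB : ∀ t, |t| ≤ α → ‖Z 1 (W t h)‖ ≤ B)
    (hS : ∀ t, |t| ≤ α → ‖Z 3 (W t h)‖ ≤ S) :
    ‖inner ℂ (average U α m (G h)) (Z 1 (average W α m h))‖ ≤
      2 * Real.pi * ‖Z 0 h - e • G h‖ * ‖G h‖ / α + α ^ 2 * (‖G h‖ * S) +
        ‖G h‖ * B / ((m : ℝ) + 1) := by
  set x := G h with hx
  have hmpos : (0 : ℝ) < m := by exact_mod_cast hm
  set τ := α / m with hτ
  have hτpos : 0 < τ := by positivity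
  have hS0 : 0 ≤ S := (norm_nonneg _).trans (hS 0 (by rw [abs_zero]; exact hα.le))
  have hB0 : 0 ≤ B := (norm_nonneg _).trans (hB 0 (by rw [abs_zero]; exact hα.le))
  set M := m + 1 with hM
  have hMpos : (0 : ℝ) < (m : ℝ) + 1 := by positivity
  set Γ : ℕ → ℕ → ℂ := fun j k => inner ℂ (U (node α m j) x) (Z 1 (W (node α m k) h)) with hΓ
  set c : ℕ → ℕ → ℂ := fun j k => ((((k : ℝ) - j)⁻¹ : ℝ) : ℂ) *
      (inner ℂ (Z 0 h) (U (((k : ℝ) - j) * τ) x) - inner ℂ x (U (((k : ℝ) - j) * τ) (Z 0 h))) with hc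
  have hnode : ∀ j ∈ Finset.range M, |node α m j| ≤ α / 2 := fun j hj =>
    abs_node_le hα.le hm (Finset.mem_range_succ_iff.1 hj)
  have hinner : inner ℂ (average U α m x) (Z 1 (average W α m h)) =
      (((((m : ℝ) + 1)⁻¹) ^ 2 : ℝ) : ℂ) * ∑ j ∈ Finset.range M, ∑ k ∈ Finset.range M, Γ j k := by
    rw [average, average, map_smul, map_sum, inner_smul_left, inner_smul_right, Complex.conj_ofReal,
      sum_inner, ← mul_assoc]
    simp only [inner_sum]
    push_cast
    rw [sq]
  -- The involution `(j, k) ↦ (m - k, m - j)` keeps the difference of the two nodes and reverses the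
  -- sign of their midpoint.
  have hrefl : ∑ j ∈ Finset.range M, ∑ k ∈ Finset.range M, Γ j k =
      ∑ j ∈ Finset.range M, ∑ k ∈ Finset.range M, (Γ j k + Γ (m - k) (m - j)) / 2 := by
    have h1 : ∑ j ∈ Finset.range M, ∑ k ∈ Finset.range M, Γ (m - k) (m - j) =
        ∑ j ∈ Finset.range M, ∑ k ∈ Finset.range M, Γ j k := by
      rw [Finset.sum_comm, ← Finset.sum_range_reflect]
      refine Finset.sum_congr rfl fun k hk => ?_
      rw [← Finset.sum_range_reflect]
      refine Finset.sum_congr rfl fun j hj => ?_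
      have := Finset.mem_range_succ_iff.1 hk
      have := Finset.mem_range_succ_iff.1 hj
      congr 1 <;> omega
    simp only [add_div, Finset.sum_add_distrib, ← Finset.sum_div]
    rw [h1]
    ring
  have hterm : ∀ j ∈ Finset.range M, ∀ k ∈ Finset.range M,
      ‖(Γ j k + Γ (m - k) (m - j)) / 2 - ((τ⁻¹ : ℝ) : ℂ) * c j k‖ ≤
        α ^ 2 * (‖x‖ * S) + if j = k then ‖x‖ * B else 0 := by
    intro j hj k hk
    have hjm := Finset.mem_range_succ_iff.1 hj
    have hkm := Finset.mem_range_succ_iff.1 hk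
    have hb : ∀ i l, ‖Γ i l‖ ≤ ‖x‖ * B ∨ ¬ l ≤ m := by
      intro i l
      by_cases hl : l ≤ m
      · left
        refine (norm_inner_le_norm _ _).trans ?_
        rw [hU.norm_map]
        gcongr
        exact hB _ ((abs_node_le hα.le hm hl).trans (by linarith))
      · exact Or.inr hl
    have hα2 : 0 ≤ α ^ 2 * (‖x‖ * S) := by positivity
    by_cases hjk : j = k
    · subst hjk
      rw [if_pos rfl]
      have h1 : c j j = 0 := by simp [hc]
      rw [h1, mul_zero, sub_zero, norm_div]
      have h2 : ‖(2 : ℂ)‖ = 2 := by norm_num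
      have h3 := (hb j j).resolve_right (by simpa using hjm)
      have h4 := (hb (m - j) (m - j)).resolve_right (by simp)
      have h5 := norm_add_le (Γ j j) (Γ (m - j) (m - j))
      rw [h2, div_le_iff₀ two_pos]
      linarith
    · rw [if_neg hjk, add_zero]
      -- In midpoint `s` and half-difference `a`, the entry and its reflection are the first
      -- derivative of one function at `s` and `-s`.
      set s := (node α m j + node α m k) / 2 with hs
      set a := (node α m k - node α m j) / 2 with ha
      have h1 := abs_le.1 (hnode j hj)
      have h2 := abs_le.1 (hnode k hk)
      have hsr : |s| ≤ α / 2 := by rw [abs_le]; constructor <;> (rw [hs]; linarith)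
      have har : |a| ≤ α / 2 := by rw [abs_le]; constructor <;> (rw [ha]; linarith)
      have ha2 : 2 * a = ((k : ℝ) - j) * τ := by rw [ha, node, node]; ring
      have hkj : (k : ℝ) - j ≠ 0 := sub_ne_zero.2 (by exact_mod_cast (Ne.symm hjk))
      have ha0 : a ≠ 0 := by
        intro h0
        rw [h0, mul_zero] at ha2
        exact (mul_ne_zero hkj hτpos.ne') ha2.symm
      have hd : ∀ (n : Fin 3) (y : ℝ), HasDerivAt
          (fun r => inner ℂ (U (r - a) (G h)) (Z n.castSucc (W (r + a) h)))
          (inner ℂ (U (y - a) (G h)) (Z n.succ (W (y + a) h))) y := fun n y =>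
        hW.hasDerivAt_inner hG hU (hZ n.castSucc) (hcomm n) hv a y
      have hb3 : ∀ y, |y| ≤ α / 2 → ‖inner ℂ (U (y - a) (G h)) (Z 3 (W (y + a) h))‖ ≤ ‖x‖ * S := by
        intro y hy
        refine (norm_inner_le_norm _ _).trans ?_
        rw [hU.norm_map]
        gcongr
        exact hS _ ((abs_add_le _ _).trans (by linarith))
      have h3 := norm_symm_add_sub_le (hd 0) (hd 1) (hd 2) hb3 hsr har ha0
      have e1 : (Γ j k + Γ (m - k) (m - j)) / 2 =
          (inner ℂ (U (s - a) (G h)) (Z 1 (W (s + a) h)) +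
            inner ℂ (U (-s - a) (G h)) (Z 1 (W (-s + a) h))) / 2 := by
        have n1 : s - a = node α m j := by rw [hs, ha]; ring
        have n2 : s + a = node α m k := by rw [hs, ha]; ring
        have n3 : -s - a = node α m (m - k) := by rw [node_reflect hm hkm, hs, ha]; ring
        have n4 : -s + a = node α m (m - j) := by rw [node_reflect hm hjm, hs, ha]; ring
        rw [n1, n2, n3, n4]
      -- At `x = ±a` one of the two group elements is the identity, so the difference is a
      -- commutator of `L` with `U (2 a)`, where `2 a = (k - j) τ`.
      have e2 : ((τ⁻¹ : ℝ) : ℂ) * c j k = (inner ℂ (U (a - a) (G h)) (Z 0 (W (a + a) h)) -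
          inner ℂ (U (-a - a) (G h)) (Z 0 (W (-a + a) h))) / (2 * a) := by
        have n1 : (2 * a : ℂ) = (((k : ℝ) - j : ℝ) : ℂ) * (τ : ℂ) := by
          rw [← Complex.ofReal_mul, ← ha2]; push_cast; rfl
        have n2 : a + a = ((k : ℝ) - j) * τ := by rw [← ha2]; ring
        have n3 : -a - a = -(((k : ℝ) - j) * τ) := by rw [← ha2]; ring
        have n4 : inner ℂ (G h) (Z 0 (W (((k : ℝ) - j) * τ) h)) =
            inner ℂ (Z 0 h) (U (((k : ℝ) - j) * τ) x) := by
          rw [← (hZ 0).symm, ← hW.apply_eq]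
        have n5 : inner ℂ (U (-(((k : ℝ) - j) * τ)) (G h)) (Z 0 h) =
            inner ℂ x (U (((k : ℝ) - j) * τ) (Z 0 h)) := by
          rw [hU.inner_map_left, neg_neg]
        rw [n1, n2, n3, sub_self, neg_add_cancel, hU.map_zero, hW.zero_apply hG hU,
          one_apply_eq_self, n4, n5, hc]
        push_cast
        rw [div_eq_mul_inv, mul_inv]
        ring
      rw [e1, e2]
      refine h3.trans ?_
      have : 0 ≤ ‖x‖ * S := by positivity
      nlinarith
  have hsum : ‖∑ j ∈ Finset.range M, ∑ k ∈ Finset.range M, Γ j k -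
      ((τ⁻¹ : ℝ) : ℂ) * ∑ j ∈ Finset.range M, ∑ k ∈ Finset.range M, c j k‖ ≤
      ((m : ℝ) + 1) ^ 2 * (α ^ 2 * (‖x‖ * S)) + ((m : ℝ) + 1) * (‖x‖ * B) := by
    rw [hrefl]
    simp only [Finset.mul_sum, ← Finset.sum_sub_distrib]
    calc _ ≤ ∑ j ∈ Finset.range M, ∑ k ∈ Finset.range M,
          (α ^ 2 * (‖x‖ * S) + if j = k then ‖x‖ * B else 0) :=
          (norm_sum_le _ _).trans (Finset.sum_le_sum fun j hj =>
            (norm_sum_le _ _).trans (Finset.sum_le_sum fun k hk => hterm j hj k hk))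
      _ = ∑ j ∈ Finset.range M, (((m : ℝ) + 1) * (α ^ 2 * (‖x‖ * S)) + ‖x‖ * B) := by
          refine Finset.sum_congr rfl fun j hj => ?_
          rw [Finset.sum_add_distrib, Finset.sum_ite_eq, if_pos hj, Finset.sum_const,
            Finset.card_range, nsmul_eq_mul, hM]
          push_cast
          rfl
      _ = _ := by
          rw [Finset.sum_const, Finset.card_range, nsmul_eq_mul, hM]
          push_cast
          ring
  have hcs := norm_sum_inner_sub_le hU τ M x (Z 0 h) he
  set s₁ := ∑ j ∈ Finset.range M, ∑ k ∈ Finset.range M, Γ j k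
  set s₂ := ∑ j ∈ Finset.range M, ∑ k ∈ Finset.range M, c j k
  set q := ‖Z 0 h - e • x‖
  have hcs' : ‖s₂‖ ≤ 2 * (((m : ℝ) + 1) * Real.pi) * q * ‖x‖ := by
    have : ((M : ℕ) : ℝ) = (m : ℝ) + 1 := by rw [hM]; push_cast; rfl
    rw [← this]; exact hcs
  have htot : ‖s₁‖ ≤ ((m : ℝ) + 1) ^ 2 * (α ^ 2 * (‖x‖ * S)) + ((m : ℝ) + 1) * (‖x‖ * B) +
      τ⁻¹ * (2 * (((m : ℝ) + 1) * Real.pi) * q * ‖x‖) := by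
    have h1 := norm_add_le (s₁ - ((τ⁻¹ : ℝ) : ℂ) * s₂) (((τ⁻¹ : ℝ) : ℂ) * s₂)
    rw [sub_add_cancel, norm_mul, Complex.norm_real, Real.norm_of_nonneg (by positivity)] at h1
    have h2 : τ⁻¹ * ‖s₂‖ ≤ τ⁻¹ * (2 * (((m : ℝ) + 1) * Real.pi) * q * ‖x‖) := by gcongr
    linarith
  rw [hinner, norm_mul, Complex.norm_real, Real.norm_of_nonneg (by positivity)]
  have hτM : τ⁻¹ ≤ ((m : ℝ) + 1) / α := by
    rw [hτ, inv_div]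
    gcongr
    linarith
  calc ((m : ℝ) + 1)⁻¹ ^ 2 * ‖s₁‖ ≤ ((m : ℝ) + 1)⁻¹ ^ 2 * (((m : ℝ) + 1) ^ 2 * (α ^ 2 * (‖x‖ * S)) +
        ((m : ℝ) + 1) * (‖x‖ * B) +
        ((m : ℝ) + 1) / α * (2 * (((m : ℝ) + 1) * Real.pi) * q * ‖x‖)) := by
        have hq : 0 ≤ q := norm_nonneg _
        refine mul_le_mul_of_nonneg_left (htot.trans ?_) (by positivity)
        gcongr
    _ = _ := by
        field_simp
        ring
end

/-! ### The virial theorem -/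

section
variable {Y A : H →ₗ.[ℂ] H} {𝒟 : Submodule ℂ H} {G : H →L[ℂ] H}

theorem norm_transported_le {W : ℝ → H →L[ℂ] H} {X : 𝒟 →ₗ[ℂ] H} {Z : H →L[ℂ] H} {T : H →ₗ.[ℂ] H}
    {c : ℝ} (hU : IsUnitaryGroupOf A (unitaryGroup A)) (hW : IsTransported G (unitaryGroup A) W)
    (hZ : IsRelativization G X Z) {t : ℝ}
    (hb : KatoBoundOn 𝒟 (conjBy A (-t) (closedOp X)) T c) {h : H} (hh : G h ∈ 𝒟)
    (hT : G h ∈ T.domain) : ‖Z (W t h)‖ ≤ c * (‖T ⟨G h, hT⟩‖ + ‖G h‖) := by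
  obtain ⟨hS, hT', hb⟩ := hb
  have h1 := hb ⟨G h, hh⟩
  refine le_trans (le_of_eq ?_) h1
  have hmem : unitaryGroup A (- -t) (G h) ∈ (closedOp X).domain := hS hh
  have h2 : (unitaryGroup A (- -t) (G h), Z (W t h)) ∈ (closedOp X).graph := by
    rw [neg_neg, hW.apply_eq]
    exact hZ.mem_graph _
  rw [(LinearPMap.image_iff hmem).2 h2, ← hU.norm_map (-t)]
  rfl

theorem inner_relativization_of_forall {L N D : 𝒟 →ₗ[ℂ] H} {ZL ZN ZD : H →L[ℂ] H}
    (hG : IsReferenceInverse Y 𝒟 G) (hL : IsRelativization G L ZL) (hN : IsRelativization G N ZN)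
    (hD : IsRelativization G D ZD)
    (hcomm : ∀ φ ψ : 𝒟, inner ℂ (φ : H) (D ψ) =
      Complex.I * (inner ℂ (L φ) (N ψ) - inner ℂ (N φ) (L ψ))) (g h : H) :
    inner ℂ (G g) (ZD h) = Complex.I * (inner ℂ (ZL g) (ZN h) - inner ℂ (ZN g) (ZL h)) := by
  have hc : IsClosed {q : H × H | inner ℂ (G q.1) (ZD q.2) =
      Complex.I * (inner ℂ (ZL q.1) (ZN q.2) - inner ℂ (ZN q.1) (ZL q.2))} :=
    isClosed_eq (by fun_prop) (by fun_prop)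
  refine hc.closure_subset_iff.2 ?_ ((hG.dense.prod hG.dense) (g, h))
  rintro ⟨g, h⟩ ⟨hg, hh⟩
  rw [Set.mem_ofPred_eq, hD.apply_eq h hh, hL.apply_eq h hh, hN.apply_eq h hh, hL.apply_eq g hg,
    hN.apply_eq g hg]
  exact hcomm ⟨G g, hg⟩ ⟨G h, hh⟩

/-- The evolved vectors `U t b` leave `𝒟` but stay in `D(Y) ∩ D(A)`. Joint-core density approximates
`(Y φ, A φ)` simultaneously, and the identity is closed in these pairs. -/
theorem inner_relativization_of_isJointCore {X X' : 𝒟 →ₗ[ℂ] H} {Z Z' : H →L[ℂ] H}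
    (hG : IsReferenceInverse Y 𝒟 G) (hZ : IsRelativization G X Z) (hZ' : IsRelativization G X' Z')
    (hdom : 𝒟 ≤ A.domain) (hcore : IsJointCore 𝒟 Y A)
    (hcomm : ∀ φ ψ : 𝒟, inner ℂ (φ : H) (X' ψ) =
      Complex.I * (inner ℂ (X φ) (A ⟨ψ, hdom ψ.2⟩) - inner ℂ (A ⟨φ, hdom φ.2⟩) (X ψ)))
    {g h u v : H} (hu : (G g, u) ∈ A.graph) (hv : (G h, v) ∈ A.graph) :
    inner ℂ (G g) (Z' h) = Complex.I * (inner ℂ (Z g) v - inner ℂ u (Z h)) := by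
  set T : Set (H × H) := {q | ∃ hq : G q.1 ∈ 𝒟, q.2 = A ⟨G q.1, hdom hq⟩} with hTd
  have hT : ∀ {g u}, (G g, u) ∈ A.graph → (g, u) ∈ closure T := by
    intro g u hu
    obtain ⟨h𝒟Y, h𝒟A, hjc⟩ := hcore
    rw [Metric.mem_closure_iff]
    intro ε hε
    have hgA := LinearPMap.mem_domain_of_mem_graph hu
    have hgY := LinearPMap.mem_domain_of_mem_graph (hG.mem_graph g)
    obtain ⟨φ, hφ⟩ := hjc (G g) hgY hgA ε hε
    rw [← (LinearPMap.image_iff hgY).2 (hG.mem_graph g), ← (LinearPMap.image_iff hgA).2 hu] at hφ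
    have hGφ : G (Y ⟨φ, h𝒟Y φ.2⟩) = φ := hG.apply_eq _ _ (Y.mem_graph ⟨φ, h𝒟Y φ.2⟩)
    refine ⟨(Y ⟨φ, h𝒟Y φ.2⟩, A ⟨φ, h𝒟A φ.2⟩), ⟨by rw [hGφ]; exact φ.2, ?_⟩, ?_⟩
    · dsimp only
      congr 1
      exact Subtype.ext hGφ.symm
    · rw [dist_comm, Prod.dist_eq, max_lt_iff, dist_eq_norm, dist_eq_norm]
      have := norm_nonneg ((φ : H) - G g)
      have := norm_nonneg (Y ⟨φ, h𝒟Y φ.2⟩ - g)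
      have := norm_nonneg (A ⟨φ, h𝒟A φ.2⟩ - u)
      constructor <;> linarith
  have hc : IsClosed {q : (H × H) × (H × H) | inner ℂ (G q.1.1) (Z' q.2.1) =
      Complex.I * (inner ℂ (Z q.1.1) q.2.2 - inner ℂ q.1.2 (Z q.2.1))} :=
    isClosed_eq (by fun_prop) (by fun_prop)
  have hmem : ((g, u), (h, v)) ∈ closure (T ×ˢ T) := by
    rw [closure_prod_eq]
    exact ⟨hT hu, hT hv⟩
  refine hc.closure_subset_iff.2 ?_ hmem
  rintro ⟨⟨a, a'⟩, ⟨b, b'⟩⟩ ⟨⟨ha, ha'⟩, ⟨hb, hb'⟩⟩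
  dsimp only at ha ha' hb hb'
  rw [Set.mem_ofPred_eq]
  dsimp only
  rw [ha', hb', hZ'.apply_eq b hb, hZ.apply_eq a ha, hZ.apply_eq b hb]
  exact hcomm ⟨G a, ha⟩ ⟨G b, hb⟩

theorem norm_rpow_half_closedOp {N : 𝒟 →ₗ[ℂ] H} {ZN : H →L[ℂ] H} (hG : IsReferenceInverse Y 𝒟 G)
    (hN : IsRelativization G N ZN) (hNs : IsSymmetricOn N)
    (h0 : ∀ ψ : 𝒟, 0 ≤ (inner ℂ (ψ : H) (N ψ)).re) {h : H}
    (hh : G h ∈ (rpow (closedOp N) (1 / 2)).domain) :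
    ‖rpow (closedOp N) (1 / 2) ⟨G h, hh⟩‖ = Real.sqrt (inner ℂ (G h) (ZN h)).re := by
  rw [← norm_rpow_half_sq (exists_isOneAddInverse_closedOp hG hN hNs h0)
    (fun _ _ _ _ => inner_graph_closedOp hG.dense_domain hNs)
    (fun _ _ => apply_of_mem_graph_closedOp_nonneg hG.dense_domain hNs h0) (hN.mem_graph h) hh,
    Real.sqrt_sq (norm_nonneg _)]

/-- Vectors near an eigenvector in which the commutator has a small expectation. -/
theorem exists_near_inner_small {U W : ℝ → H →L[ℂ] H} {N : 𝒟 →ₗ[ℂ] H} {X : Fin 4 → 𝒟 →ₗ[ℂ] H}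
    {ZN ZD : H →L[ℂ] H} {Z : Fin 4 → H →L[ℂ] H}
    (hG : IsReferenceInverse Y 𝒟 G) (hU : IsUnitaryGroupOf A U) (hW : IsTransported G U W)
    (hdom : 𝒟 ≤ A.domain) (hN : IsRelativization G N ZN)
    (hZ : ∀ n, IsRelativization G (X n) (Z n)) (hLs : IsSymmetricOn (X 0))
    (hcommD : ∀ g h, inner ℂ (G g) (ZD h) =
      Complex.I * (inner ℂ (Z 0 g) (ZN h) - inner ℂ (ZN g) (Z 0 h)))
    (hcommC : ∀ (n : Fin 3) g h u v, (G g, u) ∈ A.graph → (G h, v) ∈ A.graph →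
      inner ℂ (G g) (Z n.succ h) =
        Complex.I * (inner ℂ (Z n.castSucc g) v - inner ℂ u (Z n.castSucc h)))
    {k k' : ℝ} (hk : 0 ≤ k) (hk' : 0 ≤ k')
    (hD : ∀ h, ‖ZD h‖ ≤ k * (Real.sqrt (inner ℂ (G h) (ZN h)).re + ‖G h‖))
    (h1 : ∀ h, G h ∈ 𝒟 → ∃ B, ∀ t, ‖Z 1 (W t h)‖ ≤ k * Real.exp (k' * |t|) * B)
    (h3 : ∀ h, G h ∈ 𝒟 → ∀ t, ‖Z 3 (W t h)‖ ≤
      k * Real.exp (k' * |t|) * (Real.sqrt (inner ℂ (G h) (ZN h)).re + ‖G h‖))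
    {ψ : H} (hψ0 : ψ ≠ 0) {e : ℂ} (hψ : (ψ, e • ψ) ∈ (closedOp (X 0)).graph) {κ : ℝ} (hκ : 0 < κ) :
    ∃ h, ‖G h - ψ‖ < κ ∧ ‖inner ℂ (G h) (Z 1 h)‖ < κ := by
  have he : starRingEnd ℂ e = e := by
    have h := inner_graph_closedOp hG.dense_domain hLs hψ hψ
    rw [inner_smul_left, inner_smul_right] at h
    exact mul_right_cancel₀ (inner_self_ne_zero.2 hψ0) h
  obtain ⟨C, hC0, hC⟩ := exists_approximate_eigenvectors hG (hZ 0) hN hLs hcommD hk hD hψ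
  set B₀ := ‖ψ‖ + 1 with hB₀
  set K := 2 * Real.pi * B₀ * Real.sqrt C +
    B₀ * (k * Real.exp k' * (Real.sqrt C + B₀)) with hK
  set κ' := min (κ / 3) 1 with hκ'
  have hκ'0 : 0 < κ' := by positivity
  -- The choice `ν = α³` balances the errors: `√ν / α` from the eigenvalue equation and `α² / √ν`
  -- from `C₃` are both `√α`.
  have hpow : Tendsto (fun α : ℝ => α ^ 3) (𝓝[>] 0) (𝓝[>] 0) := by
    refine tendsto_nhdsWithin_iff.2 ⟨?_, ?_⟩
    · have : Tendsto (fun α : ℝ => α ^ 3) (𝓝[>] 0) (𝓝 (0 ^ 3)) :=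
        (Continuous.tendsto (by fun_prop) 0).mono_left nhdsWithin_le_nhds
      simpa using this
    · filter_upwards [self_mem_nhdsWithin] with α hα
      exact pow_pos (Set.mem_Ioi.1 hα) 3
  have hsqrt : ∀ᶠ α : ℝ in 𝓝[>] 0, Real.sqrt α * K < κ / 2 := by
    have : Tendsto (fun α : ℝ => Real.sqrt α * K) (𝓝[>] 0) (𝓝 (Real.sqrt 0 * K)) :=
      (Continuous.tendsto (by fun_prop) 0).mono_left nhdsWithin_le_nhds
    rw [Real.sqrt_zero, zero_mul] at this
    exact this.eventually_lt_const (by positivity)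
  have hone : ∀ᶠ α : ℝ in 𝓝[>] 0, α < 1 :=
    (tendsto_id.mono_left nhdsWithin_le_nhds).eventually_lt_const one_pos
  have hcont : ∀ᶠ α : ℝ in 𝓝[>] 0, ∀ t, |t| ≤ α / 2 → ‖U t ψ - ψ‖ < κ / 3 := by
    have h4 : Tendsto (fun t => U t ψ) (𝓝 0) (𝓝 ψ) := by
      have := (hU.continuous ψ).tendsto 0
      rwa [hU.map_zero] at this
    obtain ⟨δ, hδ, hδ'⟩ := Metric.eventually_nhds_iff.1
      (Metric.tendsto_nhds.1 h4 (κ / 3) (by positivity))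
    filter_upwards [(tendsto_id.mono_left nhdsWithin_le_nhds).eventually_lt_const hδ,
      self_mem_nhdsWithin] with α hα hα0 t ht
    rw [← dist_eq_norm]
    refine hδ' ?_
    rw [dist_eq_norm, sub_zero, Real.norm_eq_abs]
    have hα0 : 0 < α := hα0
    have hα : α < δ := hα
    linarith
  obtain ⟨α, ⟨h, hh, hhψ, hhl, hhn⟩, hαK, hα1, hαt, hα0⟩ := ((hpow.eventually (hC κ' hκ'0)).and
    (hsqrt.and (hone.and (hcont.and (eventually_mem_nhdsWithin (s := Set.Ioi 0)))))).exists
  have hα0 : 0 < α := hα0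
  set n := (inner ℂ (G h) (ZN h)).re with hn
  have hGB : ‖G h‖ ≤ B₀ := by
    have h4 := norm_add_le (G h - ψ) ψ
    rw [sub_add_cancel] at h4
    have : κ' ≤ 1 := min_le_right _ _
    linarith
  have hB₀0 : 0 < B₀ := by positivity
  set s := Real.sqrt α with hs
  have hs0 : 0 < s := Real.sqrt_pos.2 hα0
  have hss : s ^ 2 = α := Real.sq_sqrt hα0.le
  have hs1 : s ≤ 1 := by rw [hs, Real.sqrt_le_one]; exact hα1.le
  have hCs : Real.sqrt C ^ 2 = C := Real.sq_sqrt hC0.le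
  have hl : ‖Z 0 h - e • G h‖ ≤ Real.sqrt C * s * α := by
    refine (sq_le_sq₀ (norm_nonneg _) (by positivity)).1 ?_
    calc ‖Z 0 h - e • G h‖ ^ 2 ≤ C * α ^ 3 := hhl.le
      _ = Real.sqrt C ^ 2 * s ^ 2 * α ^ 2 := by rw [hCs, hss]; ring
      _ = _ := by ring
  have hnα : α ^ 2 * Real.sqrt n ≤ s * Real.sqrt C := by
    rw [← Real.sqrt_mul hα0.le]
    refine Real.le_sqrt_of_sq_le ?_
    rcases le_total n 0 with h0 | h0
    · rw [Real.sqrt_eq_zero_of_nonpos h0, mul_zero, zero_pow two_ne_zero]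
      positivity
    · rw [mul_pow, Real.sq_sqrt h0]
      calc (α ^ 2) ^ 2 * n = α * (α ^ 3 * n) := by ring
        _ ≤ α * C := by gcongr
  have hαs : α ^ 2 ≤ s := by
    have h4 : s ^ 4 ≤ s ^ 1 := pow_le_pow_of_le_one hs0.le hs1 (by norm_num)
    calc α ^ 2 = s ^ 4 := by rw [← hss]; ring
      _ ≤ s := by simpa using h4
  obtain ⟨B, hB⟩ := h1 h hh
  set B' := k * Real.exp k' * |B| with hB'
  have hexp : ∀ t, |t| ≤ α → Real.exp (k' * |t|) ≤ Real.exp k' := fun t ht => by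
    rw [Real.exp_le_exp]
    calc k' * |t| ≤ k' * 1 := by gcongr; exact ht.trans hα1.le
      _ = k' := mul_one _
  have hB1 : ∀ t, |t| ≤ α → ‖Z 1 (W t h)‖ ≤ B' := by
    intro t ht
    refine (hB t).trans ?_
    rw [hB']
    have h4 := hexp t ht
    calc k * Real.exp (k' * |t|) * B ≤ k * Real.exp (k' * |t|) * |B| := by
          gcongr; exact le_abs_self B
      _ ≤ _ := by gcongr
  have hS1 : ∀ t, |t| ≤ α → ‖Z 3 (W t h)‖ ≤ k * Real.exp k' * (Real.sqrt n + ‖G h‖) := by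
    intro t ht
    refine (h3 h hh t).trans ?_
    have h4 := hexp t ht
    gcongr
  -- `m` is chosen last: `B'` depends on `h` without any uniform control.
  obtain ⟨m, hm⟩ := exists_nat_gt (B₀ * B' / (κ / 2))
  have hB'0 : 0 ≤ B' := by positivity
  have hmpos : 0 < m := by
    have : (0 : ℝ) < m := lt_of_le_of_lt (by positivity) hm
    exact_mod_cast this
  have hmR : (0 : ℝ) < m := by exact_mod_cast hmpos
  refine ⟨average W α m h, ?_, ?_⟩
  · rw [← hW.average]
    refine lt_of_le_of_lt (norm_average_sub_le (δ := κ / 3 + κ / 3) hα0.le hmpos fun t ht => ?_)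
      (by linarith)
    have h4 : U t (G h) - ψ = U t (G h - ψ) + (U t ψ - ψ) := by rw [map_sub]; abel
    rw [h4]
    refine (norm_add_le _ _).trans ?_
    rw [hU.norm_map]
    have : κ' ≤ κ / 3 := min_le_left _ _
    have := hαt t ht
    linarith
  · rw [← hW.average]
    obtain ⟨v, hv⟩ : ∃ v, (G h, v) ∈ A.graph := ⟨_, A.mem_graph ⟨G h, hdom hh⟩⟩
    refine lt_of_le_of_lt
      (norm_inner_average_le hG hU hW hZ hcommC hv he hα0 hmpos hB1 hS1) ?_
    have t1 : 2 * Real.pi * ‖Z 0 h - e • G h‖ * ‖G h‖ / α ≤ s * (2 * Real.pi * B₀ * Real.sqrt C) := by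
      rw [div_le_iff₀ hα0]
      calc 2 * Real.pi * ‖Z 0 h - e • G h‖ * ‖G h‖ ≤ 2 * Real.pi * (Real.sqrt C * s * α) * B₀ := by
            gcongr
        _ = _ := by ring
    have t2 : α ^ 2 * (‖G h‖ * (k * Real.exp k' * (Real.sqrt n + ‖G h‖))) ≤
        s * (B₀ * (k * Real.exp k' * (Real.sqrt C + B₀))) := by
      calc α ^ 2 * (‖G h‖ * (k * Real.exp k' * (Real.sqrt n + ‖G h‖))) =
            ‖G h‖ * (k * Real.exp k' * (α ^ 2 * Real.sqrt n + α ^ 2 * ‖G h‖)) := by ring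
        _ ≤ B₀ * (k * Real.exp k' * (s * Real.sqrt C + s * B₀)) := by gcongr
        _ = _ := by ring
    have t3 : ‖G h‖ * B' / ((m : ℝ) + 1) < κ / 2 := by
      rw [div_lt_iff₀ (by positivity)] at hm ⊢
      calc ‖G h‖ * B' ≤ B₀ * B' := by gcongr
        _ < m * (κ / 2) := hm
        _ ≤ _ := by nlinarith
    have t4 : s * K = s * (2 * Real.pi * B₀ * Real.sqrt C) +
        s * (B₀ * (k * Real.exp k' * (Real.sqrt C + B₀))) := by rw [hK]; ring
    linarith
end

end Virial

end

theorem mainTheorem4 {H : Type*} [NormedAddCommGroup H] [InnerProductSpace ℂ H] [CompleteSpace H]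
    (𝒟 : Submodule ℂ H) (Λ A : H →ₗ.[ℂ] H)
    (L N D : 𝒟 →ₗ[ℂ] H) (C : Fin 4 → 𝒟 →ₗ[ℂ] H)
    -- `𝒟` is a core for the self-adjoint operator `Λ ≥ 1`, and `L, N, D, C₀, …, C₃` are
    -- symmetric on `𝒟` and form GJN triples with `Λ`
    (hΛ : Virial.IsReference Λ 𝒟)
    (hL : Virial.IsGJNTriple L Λ) (hN : Virial.IsGJNTriple N Λ) (hD : Virial.IsGJNTriple D Λ)
    (hC : ∀ n, Virial.IsGJNTriple (C n) Λ)
    (hN_nonneg : ∀ ψ : 𝒟, 0 ≤ (inner ℂ (ψ : H) (N ψ)).re)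
    -- `A` is self-adjoint, `e^{itA}` leaves `D(Λ)` invariant, `𝒟` is a joint core for `Λ` and `A`
    (hA : IsSelfAdjoint A) (hA_dom : 𝒟 ≤ A.domain)
    (hA_inv : ∀ (t : ℝ) (ψ : H), ψ ∈ Λ.domain → Virial.unitaryGroup A t ψ ∈ Λ.domain)
    (hA_core : Virial.IsJointCore 𝒟 Λ A)
    -- the commutators, in the sense of forms on `𝒟`
    (hcommD : ∀ φ ψ : 𝒟, inner ℂ (φ : H) (D ψ) =
      Complex.I * (inner ℂ (L φ) (N ψ) - inner ℂ (N φ) (L ψ)))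
    (hC0 : C 0 = L)
    (hcommC : ∀ (n : Fin 3) (φ ψ : 𝒟), inner ℂ (φ : H) (C n.succ ψ) =
      Complex.I * (inner ℂ (C n.castSucc φ) (A ⟨ψ, hA_dom ψ.2⟩) -
        inner ℂ (A ⟨φ, hA_dom φ.2⟩) (C n.castSucc ψ)))
    -- the relative bounds
    (k k' p : ℝ) (hk : 0 ≤ k) (hk' : 0 ≤ k') (hp : 0 ≤ p)
    (hboundD : Virial.KatoBoundOn 𝒟 (Virial.closedOp D)
      (Virial.rpow (Virial.closedOp N) (1 / 2)) k)
    (hboundC1 : ∀ t : ℝ, Virial.KatoBoundOn 𝒟 (Virial.conjBy A t (Virial.closedOp (C 1)))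
      (Virial.rpow (Virial.closedOp N) p) (k * Real.exp (k' * |t|)))
    (hboundC3 : ∀ t : ℝ, Virial.KatoBoundOn 𝒟 (Virial.conjBy A t (Virial.closedOp (C 3)))
      (Virial.rpow (Virial.closedOp N) (1 / 2)) (k * Real.exp (k' * |t|)))
    -- `ψ` is an eigenvector of `L`
    (ψ : (Virial.closedOp L).domain) (hψ : (ψ : H) ≠ 0) (e : ℂ)
    (heig : Virial.closedOp L ψ = e • (ψ : H)) :
    ∃ Ψ : ℝ → (Virial.closedOp (C 1)).domain,
      (∀ α : ℝ, 0 < α → (Ψ α : H) ∈ (Virial.closedOp L).domain) ∧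
      Tendsto (fun α => (Ψ α : H)) (𝓝[>] 0) (𝓝 (ψ : H)) ∧
      Tendsto (fun α => inner ℂ (Ψ α : H) (Virial.closedOp (C 1) (Ψ α))) (𝓝[>] 0) (𝓝 0) := by
  obtain ⟨G, hG⟩ := hΛ.exists_inverse
  obtain ⟨ZN, hZN⟩ := hN.exists_relativization hG
  obtain ⟨ZD, hZD⟩ := hD.exists_relativization hG
  choose Z hZ using fun n => (hC n).exists_relativization hG
  have hU := Virial.isUnitaryGroupOf_unitaryGroup hA
  obtain ⟨W, hW⟩ := Virial.exists_isTransported hG hA_inv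
  have hNs := hN.2.1
  subst hC0
  have hDb : ∀ h, ‖ZD h‖ ≤ k * (Real.sqrt (inner ℂ (G h) (ZN h)).re + ‖G h‖) := by
    intro h
    have hc : IsClosed {h | ‖ZD h‖ ≤ k * (Real.sqrt (inner ℂ (G h) (ZN h)).re + ‖G h‖)} := by
      have h1 : Continuous fun h => (inner ℂ (G h) (ZN h)).re :=
        Complex.continuous_re.comp (by fun_prop)
      exact isClosed_le (by fun_prop) (by fun_prop)
    -- The Kato bound is available only on `𝒟`. Rewriting `‖N^{1/2} b‖` as the square root of `⟪b, N
    -- b⟫` makes both sides continuous in `h`.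
    refine hc.closure_subset_iff.2 (fun g hg => ?_) (hG.dense h)
    obtain ⟨hS, hT, hb⟩ := hboundD
    have h1 := hb ⟨G g, hg⟩
    rw [Virial.norm_rpow_half_closedOp hG hZN hNs hN_nonneg,
      ← (LinearPMap.image_iff (hS hg)).2 (hZD.mem_graph g)] at h1
    exact h1
  have h1 : ∀ h, G h ∈ 𝒟 → ∃ B, ∀ t, ‖Z 1 (W t h)‖ ≤ k * Real.exp (k' * |t|) * B := by
    intro h hh
    obtain ⟨-, hT, -⟩ := hboundC1 0
    refine ⟨‖Virial.rpow (Virial.closedOp N) p ⟨G h, hT hh⟩‖ + ‖G h‖, fun t => ?_⟩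
    have := Virial.norm_transported_le hU hW (hZ 1) (hboundC1 (-t)) hh (hT hh)
    rwa [abs_neg] at this
  have h3 : ∀ h, G h ∈ 𝒟 → ∀ t, ‖Z 3 (W t h)‖ ≤
      k * Real.exp (k' * |t|) * (Real.sqrt (inner ℂ (G h) (ZN h)).re + ‖G h‖) := by
    intro h hh t
    obtain ⟨-, hT, -⟩ := hboundC3 0
    have := Virial.norm_transported_le hU hW (hZ 3) (hboundC3 (-t)) hh (hT hh)
    rwa [abs_neg, Virial.norm_rpow_half_closedOp hG hZN hNs hN_nonneg] at this
  have hgr : ((ψ : H), e • (ψ : H)) ∈ (Virial.closedOp (C 0)).graph := by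
    rw [← heig]
    exact (Virial.closedOp (C 0)).mem_graph ψ
  -- The family is indexed by the accuracy itself; for `α ≤ 0` the value is arbitrary.
  have key : ∀ α : ℝ, ∃ h, 0 < α → ‖G h - ψ‖ < α ∧ ‖inner ℂ (G h) (Z 1 h)‖ < α := by
    intro α
    by_cases hα : 0 < α
    · obtain ⟨h, hh⟩ := Virial.exists_near_inner_small hG hU hW hA_dom hZN hZ (hC 0).2.1
        (Virial.inner_relativization_of_forall hG (hZ 0) hZN hZD hcommD)
        (fun n _ _ _ _ => Virial.inner_relativization_of_isJointCore hG (hZ n.castSucc) (hZ n.succ)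
          hA_dom hA_core (hcommC n)) hk hk' hDb h1 h3 hψ hgr hα
      exact ⟨h, fun _ => hh⟩
    · exact ⟨0, fun h => absurd h hα⟩
  choose h hh using key
  have hmem : ∀ n α, G (h α) ∈ (Virial.closedOp (C n)).domain := fun n α =>
    LinearPMap.mem_domain_of_mem_graph ((hZ n).mem_graph (h α))
  have hα : Tendsto (fun α : ℝ => α) (𝓝[>] 0) (𝓝 0) := tendsto_id.mono_left nhdsWithin_le_nhds
  refine ⟨fun α => ⟨G (h α), hmem 1 α⟩, fun α _ => hmem 0 α, ?_, ?_⟩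
  · rw [tendsto_iff_norm_sub_tendsto_zero]
    refine squeeze_zero' (Eventually.of_forall fun _ => norm_nonneg _) ?_ hα
    filter_upwards [self_mem_nhdsWithin] with α h0
    exact (hh α h0).1.le
  · refine squeeze_zero_norm' ?_ hα
    filter_upwards [self_mem_nhdsWithin] with α h0
    rw [← (LinearPMap.image_iff (hmem 1 α)).2 ((hZ 1).mem_graph (h α))]
    exact (hh α h0).2.le
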